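/- Let $n\ge 3$, let $g$ be a $C^2$ Riemannian metric of positive sectional curvature on the sphere $\mathbb S^n$, and let $X\colon(\mathbb S^n,g)\to\mathbb R^{n+1}$ be a $C^2$ isometric embedding. Let $\chi$ be the second fundamental form of $X$, i.e. in local coordinates $\chi_{ij}=-\langle\partial_i\partial_jX,N\rangle$, where $N$ is a unit normal of $X$ (its choice, outer or inner, does not affect $|\chi|$). Let $\kappa$ be the minimum of all the sectional curvatures of $g$ over all tangent planes at all points of $\mathbb S^n$, and let $\Lambda$ be the maximum over $\mathbb S^n$ of the norm $|\mathrm{Ric}|=(R_{ij}R^{ij})^{1/2}$ of the Ricci tensor of $g$ (both are attained). Then at every point of $\mathbb S^n$ $$|\chi|=(\chi_{ij}\chi^{ij})^{1/2}\le C_n\,\Lambda\,\kappa^{-1/2},\qquad C_n=\frac{n}{2\sqrt{(n-1)(n-2)}},$$ where indices are raised with $g$. -/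

import Mathlib

open scoped Manifold ContDiff RealInnerProductSpace

noncomputable section

/-- The standard sphere `S^n`, the unit sphere of `ℝ^{n+1}` with Mathlib's smooth structure. -/
abbrev Sn (n : ℕ) : Type := Metric.sphere (0 : EuclideanSpace ℝ (Fin (n + 1))) 1

/-- A `C^2` Riemannian metric on `S^n`. -/
abbrev C2Metric (n : ℕ) : Type :=
  Bundle.ContMDiffRiemannianMetric (𝓡 n) 2 (EuclideanSpace ℝ (Fin n))
    (fun p : Sn n => TangentSpace (𝓡 n) p)

/-! ### Local Riemannian geometry in coordinates

`G : EuclideanSpace ℝ (Fin n) → Matrix (Fin n) (Fin n) ℝ` is the matrix `g_{ij}` of a metric in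
local coordinates. -/

/-- The `i`-th partial derivative `∂_i f` at `x`. -/
def partialDeriv {n : ℕ} {F : Type*} [NormedAddCommGroup F] [NormedSpace ℝ F] (i : Fin n)
    (f : EuclideanSpace ℝ (Fin n) → F) (x : EuclideanSpace ℝ (Fin n)) : F :=
  fderiv ℝ f x (EuclideanSpace.single i 1)

/-- The Christoffel symbol `Γ^k_{ij} = ½ g^{kl} (∂_i g_{jl} + ∂_j g_{il} - ∂_l g_{ij})`. -/
def christoffel {n : ℕ} (G : EuclideanSpace ℝ (Fin n) → Matrix (Fin n) (Fin n) ℝ)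
    (k i j : Fin n) (x : EuclideanSpace ℝ (Fin n)) : ℝ :=
  (1 / 2) * ∑ l, (G x)⁻¹ k l *
    (partialDeriv i (fun y => G y j l) x + partialDeriv j (fun y => G y i l) x
      - partialDeriv l (fun y => G y i j) x)

/-- The component along `∂_m` of
`R(∂_i, ∂_j) ∂_l = ∇_{∂_i} ∇_{∂_j} ∂_l - ∇_{∂_j} ∇_{∂_i} ∂_l`. -/
def riemannUp {n : ℕ} (G : EuclideanSpace ℝ (Fin n) → Matrix (Fin n) (Fin n) ℝ)
    (m i j l : Fin n) (x : EuclideanSpace ℝ (Fin n)) : ℝ :=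
  partialDeriv i (christoffel G m j l) x - partialDeriv j (christoffel G m i l) x
    + ∑ a, (christoffel G m i a x * christoffel G a j l x
      - christoffel G m j a x * christoffel G a i l x)

/-- The Riemann tensor `R_{ijkl} = ⟨R(∂_i, ∂_j) ∂_l, ∂_k⟩`; with this convention the sectional
curvature of the plane spanned by orthonormal `∂_i, ∂_j` is `R_{ijij}`. -/
def riemann {n : ℕ} (G : EuclideanSpace ℝ (Fin n) → Matrix (Fin n) (Fin n) ℝ)
    (i j k l : Fin n) (x : EuclideanSpace ℝ (Fin n)) : ℝ :=
  ∑ m, G x k m * riemannUp G m i j l x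

/-- The Ricci tensor `R_{jl} = g^{ik} R_{ijkl}`. -/
def ricci {n : ℕ} (G : EuclideanSpace ℝ (Fin n) → Matrix (Fin n) (Fin n) ℝ)
    (x : EuclideanSpace ℝ (Fin n)) : Matrix (Fin n) (Fin n) ℝ :=
  fun j l => ∑ i, ∑ k, (G x)⁻¹ i k * riemann G i j k l x

/-- The sectional curvature at `x` of the plane spanned by `u = u^i ∂_i` and `v = v^i ∂_i`:
`R_{ijkl} u^i v^j u^k v^l / (|u|² |v|² - ⟨u, v⟩²)`. -/
def sectional {n : ℕ} (G : EuclideanSpace ℝ (Fin n) → Matrix (Fin n) (Fin n) ℝ)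
    (x : EuclideanSpace ℝ (Fin n)) (u v : Fin n → ℝ) : ℝ :=
  (∑ i, ∑ j, ∑ k, ∑ l, riemann G i j k l x * u i * v j * u k * v l) /
    ((u ⬝ᵥ (G x).mulVec u) * (v ⬝ᵥ (G x).mulVec v) - (u ⬝ᵥ (G x).mulVec v) ^ 2)

/-- The norm `(T_{ij} T^{ij})^{1/2} = (g^{ik} g^{jl} T_{ij} T_{kl})^{1/2}` of a twice covariant
tensor `T` with respect to the metric with matrix `A = (g_{ij})`. -/
def tensorNorm {n : ℕ} (A T : Matrix (Fin n) (Fin n) ℝ) : ℝ :=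
  Real.sqrt (∑ i, ∑ j, ∑ k, ∑ l, A⁻¹ i k * A⁻¹ j l * T i j * T k l)

/-! ### Metrics and hypersurfaces on the sphere -/

/-- The matrix `g_{ij}(x) = g(∂_i, ∂_j)` of `g` in the coordinates of the chart centred at `p`,
where `∂_i` is the image of the `i`-th standard vector under the differential of the inverse
chart. -/
def chartMetric {n : ℕ} (g : C2Metric n) (p : Sn n) (x : EuclideanSpace ℝ (Fin n)) :
    Matrix (Fin n) (Fin n) ℝ :=
  fun i j => g.inner ((extChartAt (𝓡 n) p).symm x)
    (mfderiv 𝓘(ℝ, EuclideanSpace ℝ (Fin n)) (𝓡 n) (extChartAt (𝓡 n) p).symm x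
      (EuclideanSpace.single i (1 : ℝ)))
    (mfderiv 𝓘(ℝ, EuclideanSpace ℝ (Fin n)) (𝓡 n) (extChartAt (𝓡 n) p).symm x
      (EuclideanSpace.single j (1 : ℝ)))

/-- The set of all sectional curvatures of `(S^n, g)`, over all points `p` and all tangent planes
at `p`. -/
def sectionalCurvatures {n : ℕ} (g : C2Metric n) : Set ℝ :=
  {k | ∃ (p : Sn n) (u v : Fin n → ℝ), LinearIndependent ℝ ![u, v] ∧
    k = sectional (chartMetric g p) (extChartAt (𝓡 n) p p) u v}

/-- The norm `|Ric| = (R_{ij} R^{ij})^{1/2}` at `p`. -/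
def ricciNorm {n : ℕ} (g : C2Metric n) (p : Sn n) : ℝ :=
  tensorNorm (chartMetric g p (extChartAt (𝓡 n) p p))
    (ricci (chartMetric g p) (extChartAt (𝓡 n) p p))

/-- `X` is a `C^2` isometric embedding `(S^n, g) → ℝ^{n+1}`: a `C^2` topological embedding that
pulls the Euclidean inner product back to `g` (in particular, its differential is injective). -/
structure IsC2IsometricEmbedding {n : ℕ} (g : C2Metric n)
    (X : Sn n → EuclideanSpace ℝ (Fin (n + 1))) : Prop where
  contMDiff : ContMDiff (𝓡 n) 𝓘(ℝ, EuclideanSpace ℝ (Fin (n + 1))) 2 X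
  isEmbedding : Topology.IsEmbedding X
  isometric : ∀ (p : Sn n) (u v : TangentSpace (𝓡 n) p),
    inner ℝ (mvfderiv (𝓡 n) X p u) (mvfderiv (𝓡 n) X p v) = g.inner p u v

/-- `N` is a unit normal of `X` at `p`. (For an embedding there are exactly two, the outer one and
its negative.) -/
structure IsUnitNormal {n : ℕ} (X : Sn n → EuclideanSpace ℝ (Fin (n + 1))) (p : Sn n)
    (N : EuclideanSpace ℝ (Fin (n + 1))) : Prop where
  norm_eq_one : ‖N‖ = 1
  orthogonal : ∀ u : TangentSpace (𝓡 n) p,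
    inner ℝ (mvfderiv (𝓡 n) X p u) N = 0

/-- The second fundamental form `χ_{ij} = -⟨∂_i ∂_j X, N⟩` of `X` at `p` with respect to the unit
normal `N`, in the coordinates of the chart centred at `p`. -/
def secondFundamentalForm {n : ℕ} (X : Sn n → EuclideanSpace ℝ (Fin (n + 1))) (p : Sn n)
    (N : EuclideanSpace ℝ (Fin (n + 1))) : Matrix (Fin n) (Fin n) ℝ :=
  fun i j => -inner ℝ
    (partialDeriv i (partialDeriv j (X ∘ (extChartAt (𝓡 n) p).symm)) (extChartAt (𝓡 n) p p)) N

/-- The norm `|χ| = (χ_{ij} χ^{ij})^{1/2}` at `p`, taken with respect to `g`. -/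
def secondFundamentalFormNorm {n : ℕ} (g : C2Metric n)
    (X : Sn n → EuclideanSpace ℝ (Fin (n + 1))) (p : Sn n)
    (N : EuclideanSpace ℝ (Fin (n + 1))) : ℝ :=
  tensorNorm (chartMetric g p (extChartAt (𝓡 n) p p)) (secondFundamentalForm X p N)

end

/-! At a point, choose a frame that is orthonormal for $g$ and diagonalises $\chi$, with principal
curvatures $d_i$. By the Gauss equation the coordinate planes have curvature $d_id_j\ge\kappa$, and
Ric is diagonal with entries $d_i\sum_{j\ne i}d_j$. Expanding the square, $(\sum_{j\ne
i}d_j)^2\ge(n-1)(n-2)\kappa$, so $|\mathrm{Ric}|^2\ge(n-1)(n-2)\kappa\,|\chi|^2$. This is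
`tensorNorm_le_gaussRicci`; it is stronger than the claim by the factor $n/2\ge 1$.

The delicate point is the Gauss equation `riemann_eq_of_gram`, since $X$ is only $C^2$ and has no
third derivatives to commute. However, $\langle\partial_i\partial_jX,\partial_kX\rangle$ is a
combination of first derivatives of $g$, hence $C^1$, and its antisymmetrised derivative is computed
by `partialDeriv_inner_partialDeriv_sub` without differentiating $\partial_i\partial_jX$.

That $\kappa$ and $\Lambda$ are attained is a compactness argument. Charts vary with the point, so
$X$ is extended radially to a neighbourhood of the sphere, and curvatures become continuous
functions of ambient derivatives on compact sets of points, normals and orthonormal frames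
(`sectionalCurvatures_eq_image`, `range_ricciNorm_eq_image`). -/

/-! ### Calculus at low regularity. -/

/-- The product of a function continuous at `x` with one that is differentiable and vanishes at `x`
is differentiable at `x`. -/
theorem HasFDerivAt.inner_of_continuousAt {E F : Type*} [NormedAddCommGroup E] [NormedSpace ℝ E]
    [NormedAddCommGroup F] [InnerProductSpace ℝ F] {a b : E → F} {b' : E →L[ℝ] F} {x : E}
    (ha : ContinuousAt a x) (hb : HasFDerivAt b b' x) (hb0 : b x = 0) :
    HasFDerivAt (fun y => ⟪a y, b y⟫) (innerSL ℝ (a x) ∘L b') x := by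
  have h1 : HasFDerivAt (fun y => ⟪a x, b y⟫) (innerSL ℝ (a x) ∘L b') x :=
    (innerSL ℝ (a x)).hasFDerivAt.comp x hb
  -- The remainder is $o(1)\cdot O(|y-x|)$, so it has zero derivative; differentiability of `a` is
  -- never needed.
  have h2 : HasFDerivAt (fun y => ⟪a y - a x, b y⟫) (0 : E →L[ℝ] ℝ) x := by
    rw [hasFDerivAt_iff_isLittleO]
    have hO : b =O[nhds x] fun y => y - x := by
      simpa [hb0] using hb.isBigO_sub
    have ho : (fun y => a y - a x) =o[nhds x] fun _ => (1 : ℝ) := by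
      rw [Asymptotics.isLittleO_one_iff]
      exact tendsto_sub_nhds_zero_iff.mpr ha
    have hprod : (fun y => ‖a y - a x‖ * ‖b y‖) =o[nhds x] fun y => 1 * ‖y - x‖ :=
      ho.norm_left.mul_isBigO hO.norm_norm
    refine (Asymptotics.IsBigO.of_bound 1 ?_ : _ =O[nhds x] fun y => ‖a y - a x‖ * ‖b y‖).trans_isLittleO
      (hprod.trans_isBigO ?_)
    · filter_upwards with y
      simpa [hb0] using abs_real_inner_le_norm (a y - a x) (b y)
    · simpa using (Asymptotics.isBigO_refl (fun y => y - x) (nhds x)).norm_left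
  refine ((h1.add h2).congr_fderiv (add_zero _)).congr_of_eventuallyEq ?_
  filter_upwards with y
  simp [inner_sub_left]

variable {n : ℕ}

theorem HasFDerivAt.partialDeriv {F : Type*} [NormedAddCommGroup F] [NormedSpace ℝ F]
    {f : EuclideanSpace ℝ (Fin n) → F} {f' : EuclideanSpace ℝ (Fin n) →L[ℝ] F}
    {x : EuclideanSpace ℝ (Fin n)} (h : HasFDerivAt f f' x) (i : Fin n) :
    _root_.partialDeriv i f x = f' (EuclideanSpace.single i 1) := by
  rw [_root_.partialDeriv, h.fderiv]

theorem clm_eq_sum_proj (L : EuclideanSpace ℝ (Fin n) →L[ℝ] ℝ) :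
    L = ∑ j, L (EuclideanSpace.single j 1) • EuclideanSpace.proj (𝕜 := ℝ) j := by
  ext v
  conv_lhs => rw [← (EuclideanSpace.basisFun (Fin n) ℝ).sum_repr v]
  simp [mul_comm]

/-- The exterior derivative of the `1`-form `⟨dA, B⟩` with `A`, `B` merely `C^1`. -/
theorem partialDeriv_inner_partialDeriv_sub {F : Type*} [NormedAddCommGroup F]
    [InnerProductSpace ℝ F] {A B : EuclideanSpace ℝ (Fin n) → F} {x : EuclideanSpace ℝ (Fin n)}
    (hA : ContDiff ℝ 1 A) (hB : DifferentiableAt ℝ B x)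
    (hf : ∀ j, DifferentiableAt ℝ (fun y => ⟪partialDeriv j A y, B y⟫) x) (i j : Fin n) :
    partialDeriv i (fun y => ⟪partialDeriv j A y, B y⟫) x
      - partialDeriv j (fun y => ⟪partialDeriv i A y, B y⟫) x
      = ⟪partialDeriv j A x, partialDeriv i B x⟫ - ⟪partialDeriv i A x, partialDeriv j B x⟫ := by
  have hAd : Differentiable ℝ A := hA.differentiable one_ne_zero
  have hcont : ∀ j, ContinuousAt (partialDeriv j A) x := fun j =>
    ((hA.continuous_fderiv one_ne_zero).clm_apply continuous_const).continuousAt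
  have hω : ∀ j, HasFDerivAt (fun y => ⟪partialDeriv j A y, B y - B x⟫)
      (innerSL ℝ (partialDeriv j A x) ∘L fderiv ℝ B x) x := fun j =>
    HasFDerivAt.inner_of_continuousAt (hcont j) (hB.hasFDerivAt.sub_const _) (sub_self _)
  -- `q j` is the derivative of $\langle\partial_jA,B(x)\rangle$, with $B$ frozen at $x$. It exists
  -- as a difference: the full form is differentiable by `hf`, the part with $B-B(x)$ by `hω`.
  set q : Fin n → (EuclideanSpace ℝ (Fin n) →L[ℝ] ℝ) := fun j =>
    fderiv ℝ (fun y => ⟪partialDeriv j A y, B y⟫) x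
      - innerSL ℝ (partialDeriv j A x) ∘L fderiv ℝ B x with hq
  have hφ : ∀ j, HasFDerivAt (fun y => ⟪partialDeriv j A y, B x⟫) (q j) x := fun j => by
    refine ((hf j).hasFDerivAt.sub (hω j)).congr_of_eventuallyEq ?_
    filter_upwards with y
    simp [inner_sub_right]
  have hd : ∀ y, HasFDerivAt (fun y => ⟪A y, B x⟫)
      (∑ j, ⟪partialDeriv j A y, B x⟫ • EuclideanSpace.proj (𝕜 := ℝ) j) y := fun y => by
    have h := ((innerSL ℝ (B x)).hasFDerivAt.comp y (hAd y).hasFDerivAt)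
    rw [clm_eq_sum_proj (_ ∘L _)] at h
    simpa [partialDeriv, real_inner_comm, Function.comp_def] using! h
  have hdd : HasFDerivAt
      (fun y => ∑ j, ⟪partialDeriv j A y, B x⟫ • (EuclideanSpace.proj j : EuclideanSpace ℝ (Fin n) →L[ℝ] ℝ))
      (∑ j, (q j).smulRight (EuclideanSpace.proj j : EuclideanSpace ℝ (Fin n) →L[ℝ] ℝ)) x :=
    HasFDerivAt.fun_sum fun j _ =>
      (hφ j).smul_const (EuclideanSpace.proj j : EuclideanSpace ℝ (Fin n) →L[ℝ] ℝ)
  -- The frozen form is exact, with potential $\langle A,B(x)\rangle$. Symmetry of its second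
  -- derivative at $x$ only needs the gradient to be differentiable at that one point.
  have hs := second_derivative_symmetric hd hdd (EuclideanSpace.single i 1)
    (EuclideanSpace.single j 1)
  simp [hq] at hs
  simp only [partialDeriv]
  simp only [partialDeriv] at hs
  linarith

/-! ### The Gauss equation for a $C^2$ hypersurface with $C^2$ metric. -/

section Gauss

variable {F : Type*} [NormedAddCommGroup F] [InnerProductSpace ℝ F]
  {Y : EuclideanSpace ℝ (Fin n) → F}
  {G : EuclideanSpace ℝ (Fin n) → Matrix (Fin n) (Fin n) ℝ}

theorem ContDiff.partialDeriv (hY : ContDiff ℝ 2 Y) (i : Fin n) :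
    ContDiff ℝ 1 (partialDeriv i Y) :=
  (hY.fderiv_right (m := 1) (by norm_num)).clm_apply contDiff_const

theorem partialDeriv_partialDeriv (hY : ContDiff ℝ 2 Y) (i j : Fin n)
    (x : EuclideanSpace ℝ (Fin n)) :
    partialDeriv i (partialDeriv j Y) x =
      fderiv ℝ (fderiv ℝ Y) x (EuclideanSpace.single i 1) (EuclideanSpace.single j 1) := by
  have h : DifferentiableAt ℝ (fderiv ℝ Y) x :=
    (hY.fderiv_right (m := 1) (by norm_num)).differentiable one_ne_zero x
  exact (((ContinuousLinearMap.apply ℝ F (EuclideanSpace.single j (1 : ℝ))).hasFDerivAt.comp x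
    h.hasFDerivAt).partialDeriv i).trans rfl

theorem partialDeriv_comm (hY : ContDiff ℝ 2 Y) (i j : Fin n) (x : EuclideanSpace ℝ (Fin n)) :
    partialDeriv i (partialDeriv j Y) x = partialDeriv j (partialDeriv i Y) x := by
  rw [partialDeriv_partialDeriv hY, partialDeriv_partialDeriv hY]
  exact (hY.contDiffAt.isSymmSndFDerivAt (by simp)).eq _ _

theorem partialDeriv_gram (hY : ContDiff ℝ 2 Y)
    (hG : ∀ x i j, G x i j = ⟪partialDeriv i Y x, partialDeriv j Y x⟫) (i j l : Fin n)
    (x : EuclideanSpace ℝ (Fin n)) :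
    partialDeriv i (fun y => G y j l) x =
      ⟪partialDeriv i (partialDeriv j Y) x, partialDeriv l Y x⟫
        + ⟪partialDeriv i (partialDeriv l Y) x, partialDeriv j Y x⟫ := by
  have hd : ∀ j, DifferentiableAt ℝ (partialDeriv j Y) x := fun j =>
    (hY.partialDeriv j).differentiable one_ne_zero x
  simp only [hG]
  rw [((hd j).hasFDerivAt.inner ℝ (hd l).hasFDerivAt).partialDeriv i]
  simp [fderivInnerCLM_apply, partialDeriv, real_inner_comm, add_comm]

/-- The Koszul formula: in the alternating sum of three metric derivatives, symmetry of second
partials cancels all but one term. Its use is regularity: the right side is $C^1$ when the metric is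
$C^2$, although $Y$ has only two derivatives. -/
theorem inner_partialDeriv_partialDeriv (hY : ContDiff ℝ 2 Y)
    (hG : ∀ x i j, G x i j = ⟪partialDeriv i Y x, partialDeriv j Y x⟫) (i j l : Fin n)
    (x : EuclideanSpace ℝ (Fin n)) :
    ⟪partialDeriv i (partialDeriv j Y) x, partialDeriv l Y x⟫ =
      (1 / 2) * (partialDeriv i (fun y => G y j l) x + partialDeriv j (fun y => G y i l) x
        - partialDeriv l (fun y => G y i j) x) := by
  simp only [partialDeriv_gram hY hG]
  rw [partialDeriv_comm hY j i, partialDeriv_comm hY l i, partialDeriv_comm hY l j]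
  ring

theorem christoffel_eq (hY : ContDiff ℝ 2 Y)
    (hG : ∀ x i j, G x i j = ⟪partialDeriv i Y x, partialDeriv j Y x⟫) (k i j : Fin n)
    (x : EuclideanSpace ℝ (Fin n)) :
    christoffel G k i j x =
      ∑ l, (G x)⁻¹ k l * ⟪partialDeriv i (partialDeriv j Y) x, partialDeriv l Y x⟫ := by
  simp only [inner_partialDeriv_partialDeriv hY hG, christoffel, Finset.mul_sum]
  refine Finset.sum_congr rfl fun l _ => by ring

theorem sum_mul_christoffel (hY : ContDiff ℝ 2 Y)
    (hG : ∀ x i j, G x i j = ⟪partialDeriv i Y x, partialDeriv j Y x⟫)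
    (hdet : ∀ x, IsUnit (G x).det) (k i j : Fin n) (x : EuclideanSpace ℝ (Fin n)) :
    ∑ m, G x k m * christoffel G m i j x
      = ⟪partialDeriv i (partialDeriv j Y) x, partialDeriv k Y x⟫ := by
  have h : ∀ m, christoffel G m i j x = ((G x)⁻¹.mulVec fun l =>
      ⟪partialDeriv i (partialDeriv j Y) x, partialDeriv l Y x⟫) m := fun m =>
    christoffel_eq hY hG m i j x
  simp only [h]
  have := congrFun (Matrix.mulVec_mulVec (fun l =>
    ⟪partialDeriv i (partialDeriv j Y) x, partialDeriv l Y x⟫) (G x) (G x)⁻¹) k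
  rw [Matrix.mul_nonsing_inv _ (hdet x), Matrix.one_mulVec] at this
  exact this

theorem Matrix.continuousAt_inv_apply {α : Type*} [TopologicalSpace α]
    {A : α → Matrix (Fin n) (Fin n) ℝ} {x : α} (hA : ∀ i j, ContinuousAt (fun y => A y i j) x)
    (hdet : IsUnit (A x).det) (i j : Fin n) : ContinuousAt (fun y => (A y)⁻¹ i j) x := by
  have hA' : ContinuousAt A x := continuousAt_pi.2 fun i => continuousAt_pi.2 (hA i)
  have h1 : ContinuousAt (fun y => (A y).det) x :=
    (continuous_id.matrix_det.continuousAt (x := A x)).comp hA'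
  have h2 : ContinuousAt (fun y => (A y).adjugate i j) x :=
    ((continuous_id.matrix_adjugate.matrix_elem i j).continuousAt (x := A x)).comp hA'
  simp only [Matrix.inv_def, Ring.inverse_eq_inv', Matrix.smul_apply, smul_eq_mul]
  exact (h1.inv₀ hdet.ne_zero).mul h2

theorem Matrix.differentiableAt_det {E : Type*} [NormedAddCommGroup E] [NormedSpace ℝ E]
    {A : E → Matrix (Fin n) (Fin n) ℝ} {x : E}
    (hA : ∀ i j, DifferentiableAt ℝ (fun y => A y i j) x) :
    DifferentiableAt ℝ (fun y => (A y).det) x := by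
  simp only [Matrix.det_apply]
  fun_prop

theorem Matrix.differentiableAt_inv_apply {E : Type*} [NormedAddCommGroup E] [NormedSpace ℝ E]
    {A : E → Matrix (Fin n) (Fin n) ℝ} {x : E}
    (hA : ∀ i j, DifferentiableAt ℝ (fun y => A y i j) x) (hdet : IsUnit (A x).det)
    (i j : Fin n) : DifferentiableAt ℝ (fun y => (A y)⁻¹ i j) x := by
  simp only [Matrix.inv_def, Ring.inverse_eq_inv', Matrix.smul_apply, smul_eq_mul]
  refine ((Matrix.differentiableAt_det hA).inv hdet.ne_zero).mul ?_
  simp only [Matrix.adjugate_apply]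
  refine Matrix.differentiableAt_det fun a b => ?_
  by_cases h : a = j <;> simp [Matrix.updateRow_apply, h, hA]

/-- The orthogonal complement of $n$ independent vectors in dimension $n+1$ is a line, spanned by
`N`. This yields the splitting into tangential and normal parts. -/
theorem eq_zero_of_inner_eq_zero [FiniteDimensional ℝ F] (hF : Module.finrank ℝ F = n + 1)
    {v : Fin n → F} (hv : LinearIndependent ℝ v) {N W : F} (hN : N ≠ 0)
    (hNv : ∀ i, ⟪v i, N⟫ = 0) (hWv : ∀ i, ⟪v i, W⟫ = 0) (hNW : ⟪N, W⟫ = 0) : W = 0 := by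
  set S := Submodule.span ℝ (Set.range v) with hS
  have hmem : ∀ w : F, (∀ i, ⟪v i, w⟫ = 0) → w ∈ Sᗮ := fun w hw => by
    rw [hS, Submodule.mem_orthogonal]
    intro u hu
    induction hu using Submodule.span_induction with
    | mem u hu => obtain ⟨i, rfl⟩ := hu; exact hw i
    | zero => exact inner_zero_left _
    | add a b _ _ ha hb => rw [inner_add_left, ha, hb, add_zero]
    | smul c a _ ha => rw [real_inner_smul_left, ha, mul_zero]
  have h1 : Module.finrank ℝ Sᗮ = 1 := by
    have h := S.finrank_add_finrank_orthogonal
    have h' : Module.finrank ℝ S = n := by rw [hS, finrank_span_eq_card hv, Fintype.card_fin]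
    omega
  obtain ⟨c, hc⟩ := (finrank_eq_one_iff_of_nonzero' (⟨N, hmem N hNv⟩ : Sᗮ)
    (by simpa [Subtype.ext_iff] using hN)).1 h1 ⟨W, hmem W hWv⟩
  have hc' : c • N = W := congrArg Subtype.val hc
  rw [← hc', real_inner_smul_right] at hNW
  rcases mul_eq_zero.1 hNW with h | h
  · rw [← hc', h, zero_smul]
  · exact absurd (inner_self_eq_zero.1 h) hN

/-- The Gauss equation for a `C^2` hypersurface whose first fundamental form is `C^2`. -/
theorem riemann_eq_of_gram [FiniteDimensional ℝ F] (hF : Module.finrank ℝ F = n + 1)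
    (hY : ContDiff ℝ 2 Y)
    (hG : ∀ x i j, G x i j = ⟪partialDeriv i Y x, partialDeriv j Y x⟫)
    (hG2 : ∀ i j, ContDiff ℝ 2 fun x => G x i j)
    (hdet : ∀ x, IsUnit (G x).det) {x : EuclideanSpace ℝ (Fin n)} {N : F} (hN : ‖N‖ = 1)
    (hperp : ∀ i, ⟪partialDeriv i Y x, N⟫ = 0) (i j k l : Fin n) :
    riemann G i j k l x =
      ⟪partialDeriv i (partialDeriv k Y) x, N⟫ * ⟪partialDeriv j (partialDeriv l Y) x, N⟫
      - ⟪partialDeriv i (partialDeriv l Y) x, N⟫ * ⟪partialDeriv j (partialDeriv k Y) x, N⟫ := by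
  have hGd : ∀ i j, DifferentiableAt ℝ (fun y => G y i j) x := fun i j =>
    (hG2 i j).differentiable two_ne_zero x
  -- Differentiability comes from the metric through the Koszul formula, not from `Y`.
  have hcd : ∀ i j l, DifferentiableAt ℝ
      (fun y => ⟪partialDeriv i (partialDeriv j Y) y, partialDeriv l Y y⟫) x := fun i j l => by
    simp only [inner_partialDeriv_partialDeriv hY hG]
    have h : ∀ i j l, DifferentiableAt ℝ (partialDeriv i fun y => G y j l) x := fun i j l =>
      ((hG2 j l).partialDeriv i).differentiable one_ne_zero x
    exact (((h i j l).add (h j i l)).sub (h l i j)).const_mul _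
  have hΓd : ∀ k i j, DifferentiableAt ℝ (christoffel G k i j) x := fun k i j => by
    have : christoffel G k i j = fun y => _ := funext fun y => christoffel_eq hY hG k i j y
    rw [this]
    exact DifferentiableAt.fun_sum fun l _ =>
      (Matrix.differentiableAt_inv_apply hGd (hdet x) k l).mul (hcd i j l)
  have hli : LinearIndependent ℝ fun i => partialDeriv i Y x := by
    rw [← Matrix.det_gram_ne_zero_iff_linearIndependent (𝕜 := ℝ)]
    convert! (hdet x).ne_zero using 2
    ext i j
    rw [hG, Matrix.gram_apply]
  -- tangential and normal parts of the second derivatives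
  have hdecomp : ∀ j l, partialDeriv j (partialDeriv l Y) x =
      (∑ m, christoffel G m j l x • partialDeriv m Y x)
        + ⟪partialDeriv j (partialDeriv l Y) x, N⟫ • N := by
    intro j l
    refine sub_eq_zero.1 (eq_zero_of_inner_eq_zero hF hli (norm_ne_zero_iff.1 (hN ▸ one_ne_zero))
      hperp (fun i => ?_) ?_)
    · rw [inner_sub_right, inner_add_right, inner_sum, real_inner_smul_right, hperp, mul_zero,
        add_zero, real_inner_comm, ← sum_mul_christoffel hY hG hdet, sub_eq_zero]
      simp only [hG, real_inner_smul_right, mul_comm]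
    · simp [inner_sub_right, inner_add_right, inner_sum, real_inner_smul_right, hN,
        fun m => (real_inner_comm _ _).trans (hperp m),
        real_inner_comm N (partialDeriv j (partialDeriv l Y) x)]
  have hgauss : ∀ i j k l, ⟪partialDeriv j (partialDeriv l Y) x, partialDeriv i (partialDeriv k Y) x⟫
      = ∑ m, christoffel G m j l x *
          ⟪partialDeriv i (partialDeriv k Y) x, partialDeriv m Y x⟫
        + ⟪partialDeriv i (partialDeriv k Y) x, N⟫ * ⟪partialDeriv j (partialDeriv l Y) x, N⟫ := by
    intro i j k l
    conv_lhs => rw [hdecomp j l]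
    rw [inner_add_left, sum_inner, real_inner_smul_left, real_inner_comm _ N, mul_comm ⟪_, N⟫]
    refine congrArg (· + _) (Finset.sum_congr rfl fun m _ => ?_)
    rw [real_inner_smul_left, real_inner_comm]
  -- Differentiate the lowered symbol
  -- $g_{km}\Gamma^m_{jl}=\langle\partial_j\partial_lY,\partial_kY\rangle$ by the product rule and
  -- solve for the term with $\partial_i\Gamma$.
  have hder : ∀ i j l, ∑ m, G x k m * partialDeriv i (christoffel G m j l) x =
      partialDeriv i (fun y => ⟪partialDeriv j (partialDeriv l Y) y, partialDeriv k Y y⟫) x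
        - ∑ m, partialDeriv i (fun y => G y k m) x * christoffel G m j l x := by
    intro i j l
    simp only [← sum_mul_christoffel hY hG hdet k j l]
    rw [(HasFDerivAt.fun_sum (u := Finset.univ) fun m _ =>
      (hGd k m).hasFDerivAt.fun_mul (hΓd m j l).hasFDerivAt).partialDeriv i]
    simp only [sum_apply, add_apply,
      smul_apply, smul_eq_mul, Finset.sum_add_distrib, partialDeriv]
    simp only [mul_comm (christoffel G _ j l x)]
    ring
  have hquad : ∀ i j l, ∑ m, G x k m * ∑ a, christoffel G m i a x * christoffel G a j l x
      = ∑ a, ⟪partialDeriv i (partialDeriv a Y) x, partialDeriv k Y x⟫ * christoffel G a j l x := by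
    intro i j l
    simp only [← sum_mul_christoffel hY hG hdet k i, Finset.mul_sum, Finset.sum_mul]
    rw [Finset.sum_comm]
    simp only [mul_assoc]
  -- With $A=\partial_lY$ and $B=\partial_kY$, this replaces the commutation of third derivatives.
  have hcurl := partialDeriv_inner_partialDeriv_sub (hY.partialDeriv l)
    ((hY.partialDeriv k).differentiable one_ne_zero x) (fun j => hcd j l k) i j
  rw [hgauss, real_inner_comm, real_inner_comm, hgauss] at hcurl
  simp only [riemann, riemannUp, Finset.sum_sub_distrib, mul_add, mul_sub, Finset.sum_add_distrib,
    hder, hquad]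
  -- Each $\partial_ig_{km}\Gamma^m_{jl}$ splits in two: one half cancels the quadratic terms in
  -- $\Gamma$, the other the tangential part of `hcurl`. Only the normal products survive.
  simp only [partialDeriv_gram hY hG, add_mul, Finset.sum_add_distrib]
  simp only [mul_comm (christoffel G _ _ _ x)] at hcurl
  linarith

end Gauss

/-! ### The pointwise inequality, as linear algebra. -/

section MatrixAlgebra

open Matrix

/-- The Ricci tensor that the Gauss equation assigns to the first and second fundamental forms
`A` and `h`. -/
noncomputable def gaussRicci (A h : Matrix (Fin n) (Fin n) ℝ) : Matrix (Fin n) (Fin n) ℝ :=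
  (A⁻¹ᵀ * h).trace • h - h * A⁻¹ᵀ * h

theorem gaussRicci_apply (A h : Matrix (Fin n) (Fin n) ℝ) (j l : Fin n) :
    gaussRicci A h j l = ∑ i, ∑ k, A⁻¹ i k * (h i k * h j l - h i l * h j k) := by
  simp only [gaussRicci, Matrix.sub_apply, Matrix.smul_apply, smul_eq_mul, Matrix.trace,
    Matrix.diag_apply, Matrix.mul_apply, Matrix.transpose_apply, mul_sub, Finset.sum_sub_distrib,
    Finset.sum_mul]
  congr 1
  · rw [Finset.sum_comm]
    simp only [mul_assoc]
  · refine Finset.sum_congr rfl fun i _ => Finset.sum_congr rfl fun k _ => by ring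

theorem tensorNorm_eq (A T : Matrix (Fin n) (Fin n) ℝ) :
    tensorNorm A T = Real.sqrt (A⁻¹ * T * A⁻¹ᵀ * Tᵀ).trace := by
  rw [tensorNorm]
  congr 1
  simp only [Matrix.trace, Matrix.diag_apply, Matrix.mul_apply, Matrix.transpose_apply,
    Finset.sum_mul]
  refine Finset.sum_congr rfl fun i _ => Finset.sum_congr rfl fun j _ => ?_
  rw [Finset.sum_comm]
  refine Finset.sum_congr rfl fun k _ => Finset.sum_congr rfl fun l _ => by ring

theorem inv_congruence {P : Matrix (Fin n) (Fin n) ℝ} (A : Matrix (Fin n) (Fin n) ℝ) :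
    (Pᵀ * A * P)⁻¹ = P⁻¹ * A⁻¹ * P⁻¹ᵀ := by
  rw [Matrix.mul_inv_rev, Matrix.mul_inv_rev, Matrix.transpose_nonsing_inv, Matrix.mul_assoc]

theorem congruence_apply (P B : Matrix (Fin n) (Fin n) ℝ) (i j : Fin n) :
    (Pᵀ * B * P) i j = P.col i ⬝ᵥ B *ᵥ P.col j := by
  rw [Matrix.mul_assoc]
  rfl

/-- Frame independence, by cyclicity of the trace. Together with `gaussRicci_congruence` it allows
computing in any frame. -/
theorem tensorNorm_congruence {P : Matrix (Fin n) (Fin n) ℝ} (hP : IsUnit P.det)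
    (A T : Matrix (Fin n) (Fin n) ℝ) :
    tensorNorm (Pᵀ * A * P) (Pᵀ * T * P) = tensorNorm A T := by
  have h1 : P * P⁻¹ = 1 := Matrix.mul_nonsing_inv _ hP
  have h2 : P⁻¹ᵀ * Pᵀ = 1 := by rw [← Matrix.transpose_mul, h1, Matrix.transpose_one]
  rw [tensorNorm_eq, tensorNorm_eq, inv_congruence]
  congr 1
  have : P⁻¹ * A⁻¹ * P⁻¹ᵀ * (Pᵀ * T * P) * (P⁻¹ * A⁻¹ * P⁻¹ᵀ)ᵀ * (Pᵀ * T * P)ᵀ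
      = P⁻¹ * (A⁻¹ * (P⁻¹ᵀ * Pᵀ) * T * (P * P⁻¹) * A⁻¹ᵀ * (P⁻¹ᵀ * Pᵀ) * Tᵀ * P) := by
    simp only [Matrix.transpose_mul, Matrix.transpose_transpose, Matrix.mul_assoc]
  rw [this, Matrix.trace_mul_comm, h1, h2]
  simp only [Matrix.mul_assoc, h1, Matrix.mul_one]

theorem gaussRicci_congruence {P : Matrix (Fin n) (Fin n) ℝ} (hP : IsUnit P.det)
    (A h : Matrix (Fin n) (Fin n) ℝ) :
    gaussRicci (Pᵀ * A * P) (Pᵀ * h * P) = Pᵀ * gaussRicci A h * P := by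
  have h1 : P * P⁻¹ = 1 := Matrix.mul_nonsing_inv _ hP
  have h2 : P⁻¹ᵀ * Pᵀ = 1 := by rw [← Matrix.transpose_mul, h1, Matrix.transpose_one]
  have e1 : (P⁻¹ * A⁻¹ * P⁻¹ᵀ)ᵀ * (Pᵀ * h * P) = P⁻¹ * (A⁻¹ᵀ * (P⁻¹ᵀ * Pᵀ) * h * P) := by
    simp only [Matrix.transpose_mul, Matrix.transpose_transpose, Matrix.mul_assoc]
  have e2 : Pᵀ * h * P * (P⁻¹ * A⁻¹ * P⁻¹ᵀ)ᵀ * (Pᵀ * h * P)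
      = Pᵀ * (h * (P * P⁻¹) * A⁻¹ᵀ * (P⁻¹ᵀ * Pᵀ) * h) * P := by
    simp only [Matrix.transpose_mul, Matrix.transpose_transpose, Matrix.mul_assoc]
  rw [gaussRicci, inv_congruence, e1, e2, Matrix.trace_mul_comm, h1, h2, gaussRicci]
  simp only [Matrix.mul_assoc, h1, Matrix.mul_one, Matrix.mul_sub,
    Matrix.sub_mul, Matrix.smul_mul, Matrix.mul_smul]

open scoped MatrixOrder in
-- Write $A=B^{\mathsf T}B$ and use $B^{-1}$ to make $A$ the identity; an orthogonal diagonalisation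
-- of the transformed $h$ then keeps it so. The entries of `d` are the principal curvatures.
theorem exists_congruence_one_diagonal {A h : Matrix (Fin n) (Fin n) ℝ} (hA : A.PosDef)
    (hh : h.IsSymm) : ∃ (P : Matrix (Fin n) (Fin n) ℝ) (d : Fin n → ℝ),
      IsUnit P.det ∧ Pᵀ * A * P = 1 ∧ Pᵀ * h * P = diagonal d := by
  obtain ⟨Q, hQ, hAQ⟩ : ∃ Q : Matrix (Fin n) (Fin n) ℝ, IsUnit Q.det ∧ Qᵀ * A * Q = 1 := by
    obtain ⟨B, hB⟩ := CStarAlgebra.nonneg_iff_eq_star_mul_self.mp hA.posSemidef.nonneg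
    rw [Matrix.star_eq_conjTranspose, Matrix.conjTranspose_eq_transpose_of_trivial] at hB
    have hBu : IsUnit B.det := by
      refine isUnit_iff_ne_zero.2 fun h0 => hA.det_pos.ne' ?_
      rw [hB, Matrix.det_mul, h0, mul_zero]
    refine ⟨B⁻¹, Matrix.isUnit_nonsing_inv_det _ hBu, ?_⟩
    have : B⁻¹ᵀ * A * B⁻¹ = (B * B⁻¹)ᵀ * (B * B⁻¹) := by
      rw [hB, Matrix.transpose_mul]
      simp only [Matrix.mul_assoc]
    rw [this, Matrix.mul_nonsing_inv _ hBu, Matrix.transpose_one, Matrix.one_mul]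
  have hsymm : (Qᵀ * h * Q).IsHermitian := by
    rw [Matrix.IsHermitian, Matrix.conjTranspose_eq_transpose_of_trivial, Matrix.transpose_mul,
      Matrix.transpose_mul, hh.eq, Matrix.transpose_transpose, Matrix.mul_assoc]
  set U : Matrix (Fin n) (Fin n) ℝ := hsymm.eigenvectorUnitary.1 with hU
  have hUU : Uᵀ * U = 1 := by
    have := Unitary.coe_star_mul_self hsymm.eigenvectorUnitary
    rwa [Matrix.star_eq_conjTranspose, Matrix.conjTranspose_eq_transpose_of_trivial] at this
  have hUh : Uᵀ * (Qᵀ * h * Q) * U = diagonal hsymm.eigenvalues := by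
    have := hsymm.conjStarAlgAut_star_eigenvectorUnitary
    rw [Unitary.conjStarAlgAut_star_apply] at this
    rw [Matrix.star_eq_conjTranspose, Matrix.conjTranspose_eq_transpose_of_trivial] at this
    simpa using! this
  refine ⟨Q * U, hsymm.eigenvalues, ?_, ?_, ?_⟩
  · rw [Matrix.det_mul]
    exact hQ.mul (Matrix.isUnit_det_of_left_inverse hUU)
  · rw [Matrix.transpose_mul, ← hUU]
    have : Uᵀ * Qᵀ * A * (Q * U) = Uᵀ * (Qᵀ * A * Q) * U := by simp only [Matrix.mul_assoc]
    rw [this, hAQ, Matrix.mul_one]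
  · rw [Matrix.transpose_mul, ← hUh]
    simp only [Matrix.mul_assoc]

theorem tensorNorm_one_diagonal (d : Fin n → ℝ) :
    tensorNorm 1 (diagonal d) = Real.sqrt (∑ i, d i ^ 2) := by
  rw [tensorNorm_eq]
  simp [Matrix.diagonal_mul_diagonal, sq]

theorem gaussRicci_one_diagonal (d : Fin n → ℝ) :
    gaussRicci 1 (diagonal d) = diagonal fun i => d i * (∑ j, d j - d i) := by
  ext i j
  rcases eq_or_ne i j with rfl | hij
  · simp [gaussRicci, Matrix.diagonal_mul_diagonal]
    ring
  · simp [gaussRicci, Matrix.diagonal_mul_diagonal, hij]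

/-- Expand the square of $\sum_{j\ne i}d_j$: squares are nonnegative, and each of the $(n-1)(n-2)$
ordered pairs of distinct indices contributes at least $\kappa$. -/
theorem sq_sum_sub_ge {d : Fin n → ℝ} {κ : ℝ} (hd : ∀ i j, i ≠ j → κ ≤ d i * d j) (hn : 2 ≤ n)
    (i : Fin n) : ((n : ℝ) - 1) * ((n : ℝ) - 2) * κ ≤ (∑ j, d j - d i) ^ 2 := by
  have h1 : ∑ j, d j - d i = ∑ j ∈ Finset.univ.erase i, d j := by
    rw [← Finset.sum_erase_add _ _ (Finset.mem_univ i), add_sub_cancel_right]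
  have hcard : ((Finset.univ.erase i).card : ℝ) = n - 1 := by
    rw [Finset.card_erase_of_mem (Finset.mem_univ i), Finset.card_univ, Fintype.card_fin,
      Nat.cast_sub (by omega), Nat.cast_one]
  rw [h1, sq, Finset.sum_mul_sum]
  have h2 : ∀ j ∈ Finset.univ.erase i, ((n : ℝ) - 2) * κ ≤ ∑ k ∈ Finset.univ.erase i, d j * d k := by
    intro j hj
    rw [← Finset.sum_erase_add _ _ hj]
    have h3 : ((Finset.univ.erase i).erase j).card • κ ≤
        ∑ k ∈ (Finset.univ.erase i).erase j, d j * d k :=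
      Finset.card_nsmul_le_sum _ _ _ fun k hk => hd j k (Finset.ne_of_mem_erase hk).symm
    have h4 : (((Finset.univ.erase i).erase j).card : ℝ) = n - 2 := by
      rw [Finset.card_erase_of_mem hj, Finset.card_erase_of_mem (Finset.mem_univ i),
        Finset.card_univ, Fintype.card_fin, Nat.sub_sub, Nat.cast_sub hn, Nat.cast_ofNat]
    rw [nsmul_eq_mul, h4] at h3
    nlinarith [mul_self_nonneg (d j)]
  have h5 := Finset.card_nsmul_le_sum _ _ _ h2
  rwa [nsmul_eq_mul, hcard, ← mul_assoc] at h5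

/-- A lower bound `κ` on all sectional curvatures bounds the second fundamental form by the Ricci
tensor. -/
theorem tensorNorm_le_gaussRicci {A h : Matrix (Fin n) (Fin n) ℝ} (hn : 2 ≤ n) (hA : A.PosDef)
    (hh : h.IsSymm) {κ : ℝ} (hκ : 0 ≤ κ)
    (hsec : ∀ u v : Fin n → ℝ, LinearIndependent ℝ ![u, v] →
      κ * ((u ⬝ᵥ A *ᵥ u) * (v ⬝ᵥ A *ᵥ v) - (u ⬝ᵥ A *ᵥ v) ^ 2) ≤
        (u ⬝ᵥ h *ᵥ u) * (v ⬝ᵥ h *ᵥ v) - (u ⬝ᵥ h *ᵥ v) ^ 2) :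
    Real.sqrt (((n : ℝ) - 1) * ((n : ℝ) - 2) * κ) * tensorNorm A h ≤
      tensorNorm A (gaussRicci A h) := by
  obtain ⟨P, d, hP, hPA, hPh⟩ := exists_congruence_one_diagonal hA hh
  -- Apply the curvature bound to the planes spanned by two columns of `P`, that is, by two
  -- principal directions.
  have hd : ∀ i j, i ≠ j → κ ≤ d i * d j := by
    intro i j hij
    have hli : LinearIndependent ℝ ![P.col i, P.col j] := by
      have h := Matrix.linearIndependent_cols_of_isUnit ((Matrix.isUnit_iff_isUnit_det _).2 hP)
      have h2 := h.comp ![i, j] (by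
        intro a b
        fin_cases a <;> fin_cases b <;> simp [hij, hij.symm])
      convert! h2 using 1
      ext a
      fin_cases a <;> rfl
    have := hsec _ _ hli
    simpa [← congruence_apply, hPA, hPh, hij] using this
  rw [← tensorNorm_congruence hP A h, ← tensorNorm_congruence hP A (gaussRicci A h),
    ← gaussRicci_congruence hP, hPA, hPh, gaussRicci_one_diagonal, tensorNorm_one_diagonal,
    tensorNorm_one_diagonal, ← Real.sqrt_mul (by
      have : (2 : ℝ) ≤ n := by exact_mod_cast hn
      exact mul_nonneg (mul_nonneg (by linarith) (by linarith)) hκ), Finset.mul_sum]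
  refine Real.sqrt_le_sqrt (Finset.sum_le_sum fun i _ => ?_)
  rw [mul_pow, mul_comm]
  exact mul_le_mul_of_nonneg_left (sq_sum_sub_ge hd hn i) (sq_nonneg _)

end MatrixAlgebra

/-! ### Stereographic charts and the radial retraction. -/

section SphereChart

/-- The isometric inclusion of the model space as the tangent hyperplane at `p` on which the chart
centred at `p` is based. -/
noncomputable def chartFrame (p : Sn n) :
    EuclideanSpace ℝ (Fin n) →ₗᵢ[ℝ] EuclideanSpace ℝ (Fin (n + 1)) :=
  haveI := Fact.mk (@finrank_euclideanSpace_fin ℝ _ (n + 1))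
  (ℝ ∙ ((-p : Sn n) : EuclideanSpace ℝ (Fin (n + 1))))ᗮ.subtypeₗᵢ.comp
    (OrthonormalBasis.fromOrthogonalSpanSingleton n
      (ne_zero_of_mem_unit_sphere (-p))).repr.symm.toLinearIsometry

theorem inner_chartFrame (p : Sn n) (x : EuclideanSpace ℝ (Fin n)) :
    ⟪(p : EuclideanSpace ℝ (Fin (n + 1))), chartFrame p x⟫ = 0 := by
  have h : chartFrame p x ∈ (ℝ ∙ ((-p : Sn n) : EuclideanSpace ℝ (Fin (n + 1))))ᗮ :=
    Subtype.prop _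
  rw [Submodule.mem_orthogonal_singleton_iff_inner_right] at h
  simpa using h

theorem exists_chartFrame_eq (p : Sn n) {w : EuclideanSpace ℝ (Fin (n + 1))}
    (hw : ⟪(p : EuclideanSpace ℝ (Fin (n + 1))), w⟫ = 0) : ∃ x, chartFrame p x = w := by
  have := Fact.mk (@finrank_euclideanSpace_fin ℝ _ (n + 1))
  have h : w ∈ (ℝ ∙ ((-p : Sn n) : EuclideanSpace ℝ (Fin (n + 1))))ᗮ := by
    rw [Submodule.mem_orthogonal_singleton_iff_inner_right]
    simpa using hw
  refine ⟨(OrthonormalBasis.fromOrthogonalSpanSingleton n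
      (ne_zero_of_mem_unit_sphere (-p))).repr ⟨w, h⟩, ?_⟩
  exact congrArg Subtype.val (LinearIsometryEquiv.symm_apply_apply _ _)

/-- The chart centred at $p$ projects from $-p$ onto the whole model space, so coordinate
expressions are global functions and the Gauss equation above applies without localisation. -/
theorem extChartAt_sphere_target (p : Sn n) : (extChartAt (𝓡 n) p).target = Set.univ := by
  rw [extChartAt_target]
  have : (chartAt (EuclideanSpace ℝ (Fin n)) p).target = Set.univ :=
    have := Fact.mk (@finrank_euclideanSpace_fin ℝ _ (n + 1))
    stereographic'_target (-p)
  simp [this]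

theorem coe_extChartAt_sphere_symm (p : Sn n) (x : EuclideanSpace ℝ (Fin n)) :
    ((extChartAt (𝓡 n) p).symm x : EuclideanSpace ℝ (Fin (n + 1))) =
      stereoInvFunAux ((-p : Sn n) : EuclideanSpace ℝ (Fin (n + 1))) (chartFrame p x) :=
  rfl

theorem extChartAt_sphere_self (p : Sn n) : extChartAt (𝓡 n) p p = 0 := by
  have := Fact.mk (@finrank_euclideanSpace_fin ℝ _ (n + 1))
  have h : extChartAt (𝓡 n) p p = (OrthonormalBasis.fromOrthogonalSpanSingleton n
      (ne_zero_of_mem_unit_sphere (-p))).repr (stereographic (norm_eq_of_mem_sphere (-p)) p) := rfl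
  rw [h, stereographic_neg_apply, map_zero]

theorem contDiff_coe_extChartAt_sphere_symm (p : Sn n) : ContDiff ℝ 2
    fun x => ((extChartAt (𝓡 n) p).symm x : EuclideanSpace ℝ (Fin (n + 1))) := by
  simp only [coe_extChartAt_sphere_symm]
  exact contDiff_stereoInvFunAux.comp (chartFrame p).contDiff

theorem hasFDerivAt_coe_extChartAt_sphere_symm (p : Sn n) : HasFDerivAt
    (fun x => ((extChartAt (𝓡 n) p).symm x : EuclideanSpace ℝ (Fin (n + 1))))
    (chartFrame p).toContinuousLinearMap 0 := by
  simp only [coe_extChartAt_sphere_symm]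
  have h := hasFDerivAt_stereoInvFunAux ((-p : Sn n) : EuclideanSpace ℝ (Fin (n + 1)))
  exact HasFDerivAt.comp (g := stereoInvFunAux ((-p : Sn n) : EuclideanSpace ℝ (Fin (n + 1))))
    (f := chartFrame p) 0 (by rw [map_zero]; exact h) (chartFrame p).toContinuousLinearMap.hasFDerivAt

theorem extChartAt_sphere_symm_zero (p : Sn n) : (extChartAt (𝓡 n) p).symm 0 = p := by
  rw [← extChartAt_sphere_self p, extChartAt_to_inv]

theorem contMDiff_extChartAt_sphere_symm (p : Sn n) (m : ℕ∞ω) :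
    ContMDiff 𝓘(ℝ, EuclideanSpace ℝ (Fin n)) (𝓡 n) m (extChartAt (𝓡 n) p).symm := by
  have : IsManifold (𝓡 n) m (Sn n) := IsManifold.of_le le_top
  rw [← contMDiffOn_univ, ← extChartAt_sphere_target p]
  exact contMDiffOn_extChartAt_symm p

/-- Radial retraction of `ℝ^{n+1}` onto the sphere, with an arbitrary value at the origin. -/
noncomputable def radialRetraction (y : EuclideanSpace ℝ (Fin (n + 1))) : Sn n :=
  if h : y = 0 then ⟨EuclideanSpace.single 0 1, by simp⟩
  else ⟨‖y‖⁻¹ • y, by simp [norm_smul, h]⟩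

theorem radialRetraction_coe (p : Sn n) :
    radialRetraction (p : EuclideanSpace ℝ (Fin (n + 1))) = p := by
  have h : (p : EuclideanSpace ℝ (Fin (n + 1))) ≠ 0 := ne_zero_of_mem_unit_sphere p
  ext1
  simp [radialRetraction, h]

theorem coe_radialRetraction {y : EuclideanSpace ℝ (Fin (n + 1))} (hy : y ≠ 0) :
    (radialRetraction y : EuclideanSpace ℝ (Fin (n + 1))) = ‖y‖⁻¹ • y := by
  simp [radialRetraction, hy]

/-- Near $p$ the map is $y\mapsto y/|y|$ followed by stereographic projection, which is smooth away
from its pole $-p$. -/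
theorem contDiffAt_extChartAt_radialRetraction (p : Sn n) : ContDiffAt ℝ 2
    (fun y => extChartAt (𝓡 n) p (radialRetraction y)) (p : EuclideanSpace ℝ (Fin (n + 1))) := by
  have := Fact.mk (@finrank_euclideanSpace_fin ℝ _ (n + 1))
  have hp : (p : EuclideanSpace ℝ (Fin (n + 1))) ≠ 0 := ne_zero_of_mem_unit_sphere p
  have hr : ContDiffAt ℝ 2 (fun y : EuclideanSpace ℝ (Fin (n + 1)) => ‖y‖⁻¹ • y) p :=
    ((contDiffAt_norm ℝ hp).inv (norm_ne_zero_iff.2 hp)).smul contDiffAt_id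
  have hs : ContDiffAt ℝ 2
      (stereoToFun ((-p : Sn n) : EuclideanSpace ℝ (Fin (n + 1)))) (‖p.1‖⁻¹ • p.1) := by
    refine contDiffOn_stereoToFun.contDiffAt (IsOpen.mem_nhds ?_ ?_)
    · exact isOpen_ne_fun (innerSL ℝ _).continuous continuous_const
    · simp
      norm_num
  refine ((OrthonormalBasis.fromOrthogonalSpanSingleton n
      (ne_zero_of_mem_unit_sphere (-p))).repr.contDiff.contDiffAt.comp _
        (ContDiffAt.comp (f := fun y : EuclideanSpace ℝ (Fin (n + 1)) => ‖y‖⁻¹ • y) p.1 hs hr)).congr_of_eventuallyEq ?_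
  filter_upwards [isOpen_ne.mem_nhds hp] with y hy
  have h : extChartAt (𝓡 n) p (radialRetraction y) =
      (OrthonormalBasis.fromOrthogonalSpanSingleton n (ne_zero_of_mem_unit_sphere (-p))).repr
        (stereoToFun ((-p : Sn n) : EuclideanSpace ℝ (Fin (n + 1))) (radialRetraction y).1) := rfl
  rw [h, coe_radialRetraction hy]
  rfl

theorem continuousAt_radialRetraction (p : Sn n) :
    ContinuousAt radialRetraction (p : EuclideanSpace ℝ (Fin (n + 1))) := by
  have hp : (p : EuclideanSpace ℝ (Fin (n + 1))) ≠ 0 := ne_zero_of_mem_unit_sphere p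
  rw [Topology.IsInducing.subtypeVal.continuousAt_iff]
  refine ContinuousAt.congr (f := fun y => ‖y‖⁻¹ • y)
    ((continuousAt_id.norm.inv₀ (norm_ne_zero_iff.2 hp)).smul continuousAt_id) ?_
  filter_upwards [isOpen_ne.mem_nhds hp] with y hy
  exact (coe_radialRetraction hy).symm

end SphereChart

/-! ### Derivatives of the radial extension against those in charts. -/

section Extension

variable {F : Type*} [NormedAddCommGroup F] [InnerProductSpace ℝ F] {X : Sn n → F}

theorem contDiff_comp_extChartAt_symm (hX : ContMDiff (𝓡 n) 𝓘(ℝ, F) 2 X) (p : Sn n) :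
    ContDiff ℝ 2 (X ∘ (extChartAt (𝓡 n) p).symm) :=
  (hX.comp (contMDiff_extChartAt_sphere_symm p 2)).contDiff

theorem comp_radialRetraction_eventuallyEq {F : Type*} (X : Sn n → F) (p : Sn n) :
    X ∘ radialRetraction =ᶠ[nhds (p : EuclideanSpace ℝ (Fin (n + 1)))]
      (X ∘ (extChartAt (𝓡 n) p).symm) ∘ fun y => extChartAt (𝓡 n) p (radialRetraction y) := by
  have h : (extChartAt (𝓡 n) p).source ∈ nhds (radialRetraction (p : EuclideanSpace ℝ _)) := by
    rw [radialRetraction_coe]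
    exact extChartAt_source_mem_nhds p
  filter_upwards [(continuousAt_radialRetraction p).preimage_mem_nhds h] with y hy
  exact congrArg X ((extChartAt (𝓡 n) p).left_inv hy).symm

theorem contDiffAt_comp_radialRetraction (hX : ContMDiff (𝓡 n) 𝓘(ℝ, F) 2 X) (p : Sn n) :
    ContDiffAt ℝ 2 (X ∘ radialRetraction) (p : EuclideanSpace ℝ (Fin (n + 1))) :=
  ((contDiff_comp_extChartAt_symm hX p).contDiffAt.comp _
    (contDiffAt_extChartAt_radialRetraction p)).congr_of_eventuallyEq
      (comp_radialRetraction_eventuallyEq X p)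

/-- The extension gains no new directions: its differential factors through that of the chart
expression, so both have the same normals. -/
theorem fderiv_comp_radialRetraction (hX : ContMDiff (𝓡 n) 𝓘(ℝ, F) 2 X) (p : Sn n)
    (w : EuclideanSpace ℝ (Fin (n + 1))) :
    ∃ v, fderiv ℝ (X ∘ radialRetraction) p w
      = fderiv ℝ (X ∘ (extChartAt (𝓡 n) p).symm) 0 v := by
  have h0 : extChartAt (𝓡 n) p (radialRetraction (p : EuclideanSpace ℝ (Fin (n + 1)))) = 0 := by
    rw [radialRetraction_coe, extChartAt_sphere_self]
  rw [(comp_radialRetraction_eventuallyEq X p).fderiv_eq, fderiv_comp _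
    ((contDiff_comp_extChartAt_symm hX p).differentiable two_ne_zero _)
    ((contDiffAt_extChartAt_radialRetraction p).differentiableAt two_ne_zero), h0]
  exact ⟨_, rfl⟩

theorem comp_extChartAt_symm_eq {F : Type*} (X : Sn n → F) (p : Sn n) :
    X ∘ (extChartAt (𝓡 n) p).symm = (X ∘ radialRetraction) ∘
      fun x => ((extChartAt (𝓡 n) p).symm x : EuclideanSpace ℝ (Fin (n + 1))) := by
  ext1 x
  simp [radialRetraction_coe]

theorem fderiv_comp_extChartAt_symm (hX : ContMDiff (𝓡 n) 𝓘(ℝ, F) 2 X) (p : Sn n)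
    (x : EuclideanSpace ℝ (Fin n)) : fderiv ℝ (X ∘ (extChartAt (𝓡 n) p).symm) x =
      (fderiv ℝ (X ∘ radialRetraction) ((extChartAt (𝓡 n) p).symm x).1).comp
        (fderiv ℝ (fun x =>
          ((extChartAt (𝓡 n) p).symm x : EuclideanSpace ℝ (Fin (n + 1)))) x) := by
  conv_lhs => rw [comp_extChartAt_symm_eq]
  exact fderiv_comp x ((contDiffAt_comp_radialRetraction hX _).differentiableAt two_ne_zero)
    ((contDiff_coe_extChartAt_sphere_symm p).differentiable two_ne_zero x)

theorem fderiv_comp_extChartAt_symm_zero (hX : ContMDiff (𝓡 n) 𝓘(ℝ, F) 2 X) (p : Sn n)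
    (v : EuclideanSpace ℝ (Fin n)) : fderiv ℝ (X ∘ (extChartAt (𝓡 n) p).symm) 0 v =
      fderiv ℝ (X ∘ radialRetraction) p (chartFrame p v) := by
  rw [fderiv_comp_extChartAt_symm hX, (hasFDerivAt_coe_extChartAt_sphere_symm p).fderiv,
    extChartAt_sphere_symm_zero]
  rfl

/-- The second-order chain rule has an extra term, the first derivative of the extension applied to
the second derivative of the inverse chart; it is tangential, and `N` kills it. -/
theorem inner_fderiv_fderiv_comp_extChartAt_symm (hX : ContMDiff (𝓡 n) 𝓘(ℝ, F) 2 X) (p : Sn n)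
    {N : F} (hN : ∀ w, ⟪fderiv ℝ (X ∘ radialRetraction) p w, N⟫ = 0)
    (u v : EuclideanSpace ℝ (Fin n)) :
    ⟪fderiv ℝ (fderiv ℝ (X ∘ (extChartAt (𝓡 n) p).symm)) 0 u v, N⟫ =
      ⟪fderiv ℝ (fderiv ℝ (X ∘ radialRetraction)) p (chartFrame p u) (chartFrame p v), N⟫ := by
  set σ := fun x => ((extChartAt (𝓡 n) p).symm x : EuclideanSpace ℝ (Fin (n + 1))) with hσ
  have hσ0 : σ 0 = p := congrArg Subtype.val (extChartAt_sphere_symm_zero p)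
  have h1 : HasFDerivAt (fderiv ℝ (X ∘ radialRetraction))
      (fderiv ℝ (fderiv ℝ (X ∘ radialRetraction)) p) (σ 0) := by
    rw [hσ0]
    exact (((contDiffAt_comp_radialRetraction hX p).fderiv_right
      (m := 1) (by norm_num)).differentiableAt one_ne_zero).hasFDerivAt
  have h2 : HasFDerivAt (fderiv ℝ σ) (fderiv ℝ (fderiv ℝ σ) 0) 0 :=
    (((contDiff_coe_extChartAt_sphere_symm p).fderiv_right
      (m := 1) (by norm_num)).differentiable one_ne_zero 0).hasFDerivAt
  have h3 := (h1.comp 0 (hasFDerivAt_coe_extChartAt_sphere_symm p)).clm_comp h2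
  have h4 : fderiv ℝ (X ∘ (extChartAt (𝓡 n) p).symm) = fun x =>
      ((fderiv ℝ (X ∘ radialRetraction) ∘ σ) x).comp (fderiv ℝ σ x) :=
    funext fun x => fderiv_comp_extChartAt_symm hX p x
  rw [(hasFDerivAt_coe_extChartAt_sphere_symm p).fderiv] at h3
  rw [h4, h3.fderiv]
  have h5 := hN (fderiv ℝ (fderiv ℝ σ) 0 u v)
  rw [← hσ0] at h5
  simp only [add_apply, inner_add_left]
  exact (congrArg (· + _) h5).trans (zero_add _)

end Extension

/-! ### Regularity and positivity of the metric in coordinates. -/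

section ChartMetric

theorem contMDiff_mfderiv_apply_const {E E' H M : Type*} [NormedAddCommGroup E] [NormedSpace ℝ E]
    [NormedAddCommGroup E'] [NormedSpace ℝ E'] [TopologicalSpace H] {I : ModelWithCorners ℝ E' H}
    [TopologicalSpace M] [ChartedSpace H M] [IsManifold I 1 M] {f : E → M} {m k : ℕ∞ω}
    (hf : ContMDiff 𝓘(ℝ, E) I k f) (hmk : m + 1 ≤ k) (v : E) :
    ContMDiff 𝓘(ℝ, E) (I.prod 𝓘(ℝ, E')) m
      fun x => (Bundle.TotalSpace.mk' E' (f x) (mfderiv 𝓘(ℝ, E) I f x v) : TangentBundle I M) := by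
  have h1 : ContMDiff 𝓘(ℝ, E) (𝓘(ℝ, E).prod 𝓘(ℝ, E)) m
      fun x => (Bundle.TotalSpace.mk' E x v : TangentBundle 𝓘(ℝ, E) E) :=
    contMDiff_vectorSpace_iff_contDiff.2 contDiff_const
  exact (hf.contMDiff_tangentMap hmk).comp h1

variable {g : C2Metric n} {X : Sn n → EuclideanSpace ℝ (Fin (n + 1))}

theorem fderiv_comp_extChartAt_symm_eq_mvfderiv
    (hX : ContMDiff (𝓡 n) 𝓘(ℝ, EuclideanSpace ℝ (Fin (n + 1))) 2 X) (p : Sn n)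
    (x v : EuclideanSpace ℝ (Fin n)) : fderiv ℝ (X ∘ (extChartAt (𝓡 n) p).symm) x v =
      mvfderiv (𝓡 n) X ((extChartAt (𝓡 n) p).symm x)
        (mfderiv 𝓘(ℝ, EuclideanSpace ℝ (Fin n)) (𝓡 n) (extChartAt (𝓡 n) p).symm x v) := by
  rw [← mfderiv_eq_fderiv, mfderiv_comp x ((hX _).mdifferentiableAt two_ne_zero)
    ((contMDiff_extChartAt_sphere_symm p 1 x).mdifferentiableAt one_ne_zero)]
  rfl

theorem chartMetric_eq (hX : IsC2IsometricEmbedding g X) (p : Sn n)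
    (x : EuclideanSpace ℝ (Fin n)) (i j : Fin n) : chartMetric g p x i j =
      ⟪partialDeriv i (X ∘ (extChartAt (𝓡 n) p).symm) x,
        partialDeriv j (X ∘ (extChartAt (𝓡 n) p).symm) x⟫ := by
  rw [partialDeriv, partialDeriv, fderiv_comp_extChartAt_symm_eq_mvfderiv hX.contMDiff,
    fderiv_comp_extChartAt_symm_eq_mvfderiv hX.contMDiff, hX.isometric]
  rfl

theorem contDiff_chartMetric (g : C2Metric n) (p : Sn n) (i j : Fin n) :
    ContDiff ℝ 2 fun x => chartMetric g p x i j := by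
  -- Order 3 because one derivative is lost in passing to the coordinate vector fields, which must
  -- be $C^2$.
  have hψ := contMDiff_extChartAt_sphere_symm p 3
  have hv : ∀ i : Fin n, ContMDiff 𝓘(ℝ, EuclideanSpace ℝ (Fin n))
      ((𝓡 n).prod 𝓘(ℝ, EuclideanSpace ℝ (Fin n))) 2
      fun x => (Bundle.TotalSpace.mk' (EuclideanSpace ℝ (Fin n)) ((extChartAt (𝓡 n) p).symm x)
        (mfderiv 𝓘(ℝ, EuclideanSpace ℝ (Fin n)) (𝓡 n) (extChartAt (𝓡 n) p).symm x
          (EuclideanSpace.single i (1 : ℝ))) : TangentBundle (𝓡 n) (Sn n)) := fun i =>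
    contMDiff_mfderiv_apply_const hψ (by norm_num) _
  have h : ContMDiff 𝓘(ℝ, EuclideanSpace ℝ (Fin n)) ((𝓡 n).prod 𝓘(ℝ)) 2
      (fun x => Bundle.TotalSpace.mk' ℝ (E := Bundle.Trivial (Sn n) ℝ)
        ((extChartAt (𝓡 n) p).symm x) (chartMetric g p x i j)) := by
    apply ContMDiff.clm_bundle_apply₂ (F₁ := EuclideanSpace ℝ (Fin n))
      (F₂ := EuclideanSpace ℝ (Fin n)) (E₁ := fun p : Sn n => TangentSpace (𝓡 n) p)
      (E₂ := fun p : Sn n => TangentSpace (𝓡 n) p)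
    · exact g.contMDiff.comp (hψ.of_le (by norm_num))
    · exact hv i
    · exact hv j
  rw [← contMDiff_iff_contDiff]
  intro x
  have hx := h x
  rw [Bundle.contMDiffAt_totalSpace] at hx
  exact hx.2

theorem injective_fderiv_comp_extChartAt_symm (hX : IsC2IsometricEmbedding g X) (p : Sn n)
    (x : EuclideanSpace ℝ (Fin n)) :
    Function.Injective (fderiv ℝ (X ∘ (extChartAt (𝓡 n) p).symm) x) := by
  rw [injective_iff_map_eq_zero]
  intro v hv
  have : IsManifold (𝓡 n) 1 (Sn n) := IsManifold.of_le (n := ω) le_top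
  have hinv := (isInvertible_mfderivWithin_extChartAt_symm (I := 𝓡 n) (x := p) (y := x)
    (by rw [extChartAt_sphere_target]; trivial)).injective
  rw [show Set.range (𝓡 n) = Set.univ by simp, mfderivWithin_univ] at hinv
  rw [fderiv_comp_extChartAt_symm_eq_mvfderiv hX.contMDiff] at hv
  refine (injective_iff_map_eq_zero _).1 hinv v ?_
  by_contra hne
  have hpos := g.pos _ _ hne
  rw [← hX.isometric, hv, inner_zero_left] at hpos
  exact hpos.false

theorem posDef_chartMetric (hX : IsC2IsometricEmbedding g X) (p : Sn n)
    (x : EuclideanSpace ℝ (Fin n)) : (chartMetric g p x).PosDef := by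
  have h : chartMetric g p x =
      Matrix.gram ℝ fun i => partialDeriv i (X ∘ (extChartAt (𝓡 n) p).symm) x := by
    ext i j
    rw [chartMetric_eq hX, Matrix.gram_apply]
  rw [h]
  refine Matrix.posDef_gram_of_linearIndependent ?_
  have hli := (EuclideanSpace.basisFun (Fin n) ℝ).toBasis.linearIndependent.map'
    (fderiv ℝ (X ∘ (extChartAt (𝓡 n) p).symm) x).toLinearMap
    (LinearMap.ker_eq_bot.2 (injective_fderiv_comp_extChartAt_symm hX p x))
  convert! hli using 1
  ext1 i
  simp [partialDeriv]

end ChartMetric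

open scoped Matrix

/-! ### Curvatures of the sphere through the second fundamental form. -/

section GaussOnSphere

variable {g : C2Metric n} {X : Sn n → EuclideanSpace ℝ (Fin (n + 1))}

/-- `N` is a unit vector orthogonal to the image of the differential of the radial extension
of `X` at `p`. -/
def IsAmbientNormal (X : Sn n → EuclideanSpace ℝ (Fin (n + 1))) (p : Sn n)
    (N : EuclideanSpace ℝ (Fin (n + 1))) : Prop :=
  ‖N‖ = 1 ∧ ∀ w, ⟪fderiv ℝ (X ∘ radialRetraction) p w, N⟫ = 0

theorem IsUnitNormal.isAmbientNormal (hX : IsC2IsometricEmbedding g X) {p : Sn n}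
    {N : EuclideanSpace ℝ (Fin (n + 1))} (hN : IsUnitNormal X p N) : IsAmbientNormal X p N := by
  refine ⟨hN.norm_eq_one, fun w => ?_⟩
  obtain ⟨v, hv⟩ := fderiv_comp_radialRetraction hX.contMDiff p w
  have h : ∀ q : Sn n, q = p → ∀ u : TangentSpace (𝓡 n) q, ⟪mvfderiv (𝓡 n) X q u, N⟫ = 0 := by
    rintro q rfl u
    exact hN.orthogonal u
  rw [hv, fderiv_comp_extChartAt_symm_eq_mvfderiv hX.contMDiff]
  exact h _ (extChartAt_sphere_symm_zero p) _

/-- The tangent image has dimension at most $n$ in $\mathbb R^{n+1}$. Attainment of $\kappa$ and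
$\Lambda$ has to be shown before any normal is given. -/
theorem exists_isAmbientNormal (hX : IsC2IsometricEmbedding g X) (p : Sn n) :
    ∃ N, IsAmbientNormal X p N := by
  set R := (fderiv ℝ (X ∘ (extChartAt (𝓡 n) p).symm) 0).toLinearMap.range with hR
  have h1 : Module.finrank ℝ R ≤ n := by
    have h := (fderiv ℝ (X ∘ (extChartAt (𝓡 n) p).symm) 0).toLinearMap.finrank_range_le
    rwa [finrank_euclideanSpace_fin] at h
  have h2 : 0 < Module.finrank ℝ Rᗮ := by
    have h := R.finrank_add_finrank_orthogonal
    rw [finrank_euclideanSpace_fin] at h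
    omega
  obtain ⟨⟨N, hN⟩, hN0⟩ := Module.finrank_pos_iff_exists_ne_zero.1 h2
  have hN0' : N ≠ 0 := fun h => hN0 (Subtype.ext h)
  refine ⟨‖N‖⁻¹ • N, by simp [norm_smul, hN0'], fun w => ?_⟩
  obtain ⟨v, hv⟩ := fderiv_comp_radialRetraction hX.contMDiff p w
  have h := (Submodule.mem_orthogonal _ _).1 hN (fderiv ℝ (X ∘ (extChartAt (𝓡 n) p).symm) 0 v)
    ⟨v, rfl⟩
  rw [hv, real_inner_smul_right, h, mul_zero]

theorem isSymm_secondFundamentalForm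
    (hX : ContMDiff (𝓡 n) 𝓘(ℝ, EuclideanSpace ℝ (Fin (n + 1))) 2 X) (p : Sn n)
    (N : EuclideanSpace ℝ (Fin (n + 1))) : (secondFundamentalForm X p N).IsSymm := by
  refine Matrix.IsSymm.ext fun i j => ?_
  rw [secondFundamentalForm, secondFundamentalForm,
    partialDeriv_comm (contDiff_comp_extChartAt_symm hX p)]

theorem riemann_chartMetric (hX : IsC2IsometricEmbedding g X) {p : Sn n}
    {N : EuclideanSpace ℝ (Fin (n + 1))} (hN : IsAmbientNormal X p N) (i j k l : Fin n) :
    riemann (chartMetric g p) i j k l (extChartAt (𝓡 n) p p) =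
      secondFundamentalForm X p N i k * secondFundamentalForm X p N j l
        - secondFundamentalForm X p N i l * secondFundamentalForm X p N j k := by
  rw [riemann_eq_of_gram finrank_euclideanSpace_fin
    (contDiff_comp_extChartAt_symm hX.contMDiff p) (chartMetric_eq hX p)
    (contDiff_chartMetric g p) (fun x => isUnit_iff_ne_zero.2 (posDef_chartMetric hX p x).det_pos.ne')
    hN.1 (fun i => ?_)]
  · simp only [secondFundamentalForm, neg_mul_neg]
  · rw [extChartAt_sphere_self, partialDeriv, fderiv_comp_extChartAt_symm_zero hX.contMDiff]
    exact hN.2 _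

theorem ricci_chartMetric (hX : IsC2IsometricEmbedding g X) {p : Sn n}
    {N : EuclideanSpace ℝ (Fin (n + 1))} (hN : IsAmbientNormal X p N) :
    ricci (chartMetric g p) (extChartAt (𝓡 n) p p) =
      gaussRicci (chartMetric g p (extChartAt (𝓡 n) p p)) (secondFundamentalForm X p N) := by
  ext j l
  rw [gaussRicci_apply, ricci]
  simp only [riemann_chartMetric hX hN]

theorem dotProduct_mulVec_eq_sum (h : Matrix (Fin n) (Fin n) ℝ) (u v : Fin n → ℝ) :
    u ⬝ᵥ h *ᵥ v = ∑ i, ∑ j, h i j * u i * v j := by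
  simp only [dotProduct, Matrix.mulVec, Finset.mul_sum]
  refine Finset.sum_congr rfl fun i _ => Finset.sum_congr rfl fun j _ => by ring

theorem sectional_chartMetric (hX : IsC2IsometricEmbedding g X) {p : Sn n}
    {N : EuclideanSpace ℝ (Fin (n + 1))} (hN : IsAmbientNormal X p N) (u v : Fin n → ℝ) :
    sectional (chartMetric g p) (extChartAt (𝓡 n) p p) u v =
      ((u ⬝ᵥ secondFundamentalForm X p N *ᵥ u) * (v ⬝ᵥ secondFundamentalForm X p N *ᵥ v)
        - (u ⬝ᵥ secondFundamentalForm X p N *ᵥ v) ^ 2) /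
      ((u ⬝ᵥ chartMetric g p (extChartAt (𝓡 n) p p) *ᵥ u)
        * (v ⬝ᵥ chartMetric g p (extChartAt (𝓡 n) p p) *ᵥ v)
        - (u ⬝ᵥ chartMetric g p (extChartAt (𝓡 n) p p) *ᵥ v) ^ 2) := by
  rw [sectional]
  congr 1
  have hsymm : u ⬝ᵥ secondFundamentalForm X p N *ᵥ v = v ⬝ᵥ secondFundamentalForm X p N *ᵥ u := by
    rw [Matrix.dotProduct_mulVec, ← Matrix.mulVec_transpose,
      (isSymm_secondFundamentalForm hX.contMDiff p N).eq, dotProduct_comm]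
  rw [sq]
  nth_rw 2 [hsymm]
  simp only [riemann_chartMetric hX hN]
  generalize secondFundamentalForm X p N = h
  simp only [sub_mul, Finset.sum_sub_distrib]
  congr 1
  · rw [dotProduct_mulVec_eq_sum, dotProduct_mulVec_eq_sum, Finset.sum_mul]
    refine Finset.sum_congr rfl fun i _ => ?_
    rw [Finset.sum_mul, Finset.sum_comm]
    refine Finset.sum_congr rfl fun k _ => ?_
    rw [Finset.mul_sum]
    refine Finset.sum_congr rfl fun j _ => ?_
    rw [Finset.mul_sum]
    exact Finset.sum_congr rfl fun l _ => by ring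
  · rw [dotProduct_mulVec_eq_sum, dotProduct_mulVec_eq_sum, Finset.sum_mul]
    refine Finset.sum_congr rfl fun i _ => ?_
    rw [Finset.sum_mul]
    have : ∀ j, ∑ k, ∑ l, h i l * h j k * u i * v j * u k * v l =
        ∑ l, ∑ k, h i l * h j k * u i * v j * u k * v l := fun j => Finset.sum_comm
    simp only [this]
    rw [Finset.sum_comm]
    refine Finset.sum_congr rfl fun l _ => ?_
    rw [Finset.mul_sum]
    refine Finset.sum_congr rfl fun j _ => ?_
    rw [Finset.mul_sum]
    exact Finset.sum_congr rfl fun k _ => by ring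

end GaussOnSphere

/-! ### Fundamental forms on ambient vectors. -/

section Ambient

variable {g : C2Metric n} {X : Sn n → EuclideanSpace ℝ (Fin (n + 1))}

/-- The first fundamental form of `X` on ambient vectors at `p`. -/
noncomputable def ambientMetric (X : Sn n → EuclideanSpace ℝ (Fin (n + 1))) (p : Sn n)
    (U V : EuclideanSpace ℝ (Fin (n + 1))) : ℝ :=
  ⟪fderiv ℝ (X ∘ radialRetraction) p U, fderiv ℝ (X ∘ radialRetraction) p V⟫

/-- The second fundamental form of `X` on ambient vectors at `p`. -/
noncomputable def ambientForm (X : Sn n → EuclideanSpace ℝ (Fin (n + 1))) (p : Sn n)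
    (N U V : EuclideanSpace ℝ (Fin (n + 1))) : ℝ :=
  -⟪fderiv ℝ (fderiv ℝ (X ∘ radialRetraction)) p U V, N⟫

theorem toLp_eq_sum_single (u : Fin n → ℝ) :
    WithLp.toLp 2 u = ∑ i, u i • EuclideanSpace.single i (1 : ℝ) := by
  ext j
  simp [Pi.single_apply]

theorem dotProduct_chartMetric_mulVec (hX : IsC2IsometricEmbedding g X) (p : Sn n)
    (u v : Fin n → ℝ) : u ⬝ᵥ chartMetric g p (extChartAt (𝓡 n) p p) *ᵥ v =
      ambientMetric X p (chartFrame p (WithLp.toLp 2 u)) (chartFrame p (WithLp.toLp 2 v)) := by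
  rw [dotProduct_mulVec_eq_sum, ambientMetric, toLp_eq_sum_single, toLp_eq_sum_single]
  simp only [map_sum, map_smul, sum_inner, inner_sum, real_inner_smul_left, real_inner_smul_right]
  rw [Finset.sum_comm]
  refine Finset.sum_congr rfl fun i _ => Finset.sum_congr rfl fun j _ => ?_
  rw [chartMetric_eq hX, extChartAt_sphere_self, partialDeriv, partialDeriv,
    fderiv_comp_extChartAt_symm_zero hX.contMDiff, fderiv_comp_extChartAt_symm_zero hX.contMDiff]
  ring

theorem dotProduct_secondFundamentalForm_mulVec (hX : IsC2IsometricEmbedding g X) {p : Sn n}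
    {N : EuclideanSpace ℝ (Fin (n + 1))} (hN : IsAmbientNormal X p N)
    (u v : Fin n → ℝ) : u ⬝ᵥ secondFundamentalForm X p N *ᵥ v =
      ambientForm X p N (chartFrame p (WithLp.toLp 2 u)) (chartFrame p (WithLp.toLp 2 v)) := by
  rw [dotProduct_mulVec_eq_sum, ambientForm, toLp_eq_sum_single, toLp_eq_sum_single]
  simp only [map_sum, map_smul, sum_inner, real_inner_smul_left,
    sum_apply, smul_apply, Finset.mul_sum, ← Finset.sum_neg_distrib]
  rw [Finset.sum_comm]
  refine Finset.sum_congr rfl fun i _ => Finset.sum_congr rfl fun j _ => ?_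
  rw [secondFundamentalForm, extChartAt_sphere_self,
    partialDeriv_partialDeriv (contDiff_comp_extChartAt_symm hX.contMDiff p),
    inner_fderiv_fderiv_comp_extChartAt_symm hX.contMDiff p hN.2]
  ring

theorem ambientForm_comm (hX : ContMDiff (𝓡 n) 𝓘(ℝ, EuclideanSpace ℝ (Fin (n + 1))) 2 X)
    (p : Sn n) (N U V : EuclideanSpace ℝ (Fin (n + 1))) :
    ambientForm X p N U V = ambientForm X p N V U := by
  rw [ambientForm, ambientForm,
    ((contDiffAt_comp_radialRetraction hX p).isSymmSndFDerivAt (by simp)).eq]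

/-- The sectional curvature of the plane spanned by `U` and `V` in terms of the fundamental
forms. -/
noncomputable def ambientSectional (X : Sn n → EuclideanSpace ℝ (Fin (n + 1))) (p : Sn n)
    (N U V : EuclideanSpace ℝ (Fin (n + 1))) : ℝ :=
  (ambientForm X p N U U * ambientForm X p N V V - ambientForm X p N U V ^ 2) /
    (ambientMetric X p U U * ambientMetric X p V V - ambientMetric X p U V ^ 2)

theorem sectional_eq_ambientSectional (hX : IsC2IsometricEmbedding g X) {p : Sn n}
    {N : EuclideanSpace ℝ (Fin (n + 1))} (hN : IsAmbientNormal X p N) (u v : Fin n → ℝ) :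
    sectional (chartMetric g p) (extChartAt (𝓡 n) p p) u v = ambientSectional X p N
      (chartFrame p (WithLp.toLp 2 u)) (chartFrame p (WithLp.toLp 2 v)) := by
  rw [sectional_chartMetric hX hN, ambientSectional]
  simp only [dotProduct_chartMetric_mulVec hX, dotProduct_secondFundamentalForm_mulVec hX hN]

/-- Numerator and denominator are both $2\times2$ determinants of symmetric forms, so a triangular
change of basis multiplies each by $(ac)^2$. -/
theorem ambientSectional_smul_add
    (hX : ContMDiff (𝓡 n) 𝓘(ℝ, EuclideanSpace ℝ (Fin (n + 1))) 2 X) (p : Sn n)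
    (N U V : EuclideanSpace ℝ (Fin (n + 1))) {a c : ℝ} (b : ℝ) (ha : a ≠ 0) (hc : c ≠ 0) :
    ambientSectional X p N (a • U) (b • U + c • V) = ambientSectional X p N U V := by
  have h1 : ambientForm X p N (a • U) (a • U) *
        ambientForm X p N (b • U + c • V) (b • U + c • V)
      - ambientForm X p N (a • U) (b • U + c • V) ^ 2 = (a * c) ^ 2 *
        (ambientForm X p N U U * ambientForm X p N V V - ambientForm X p N U V ^ 2) := by
    have hs := ambientForm_comm hX p N U V
    simp only [ambientForm, map_add, map_smul, add_apply, smul_apply,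
      inner_add_left, real_inner_smul_left] at hs ⊢
    rw [neg_inj] at hs
    rw [hs]
    ring
  have h2 : ambientMetric X p (a • U) (a • U) * ambientMetric X p (b • U + c • V) (b • U + c • V)
      - ambientMetric X p (a • U) (b • U + c • V) ^ 2 = (a * c) ^ 2 *
        (ambientMetric X p U U * ambientMetric X p V V - ambientMetric X p U V ^ 2) := by
    simp only [ambientMetric, map_add, map_smul, inner_add_left, inner_add_right,
      real_inner_smul_left, real_inner_smul_right]
    rw [real_inner_comm (fderiv ℝ (X ∘ radialRetraction) p U) (fderiv ℝ (X ∘ radialRetraction) p V)]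
    ring
  rw [ambientSectional, h1, h2, mul_div_mul_left _ _ (pow_ne_zero 2 (mul_ne_zero ha hc)),
    ambientSectional]

/-- Gram–Schmidt, solved for the original vectors so as to match the triangular substitution above.
-/
theorem exists_orthonormal_pair {E : Type*} [NormedAddCommGroup E] [InnerProductSpace ℝ E]
    {u v : E} (h : LinearIndependent ℝ ![u, v]) : ∃ (u' v' : E) (a b c : ℝ), a ≠ 0 ∧ c ≠ 0 ∧
      u = a • u' ∧ v = b • u' + c • v' ∧ ‖u'‖ = 1 ∧ ‖v'‖ = 1 ∧ ⟪u', v'⟫ = 0 := by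
  rw [LinearIndependent.pair_iff] at h
  have hu : u ≠ 0 := fun h0 => one_ne_zero (h 1 0 (by simp [h0])).1
  have hu' : ‖u‖ ≠ 0 := norm_ne_zero_iff.2 hu
  set u' := ‖u‖⁻¹ • u with hu'def
  have hn : ‖u'‖ = 1 := by simp [hu'def, norm_smul, hu]
  set w := v - ⟪u', v⟫ • u' with hw
  have hw0 : w ≠ 0 := fun h0 => by
    refine one_ne_zero (h (-(⟪u', v⟫ * ‖u‖⁻¹)) 1 ?_).2
    rw [← h0, hw, hu'def, smul_smul]
    module
  have hw0' : ‖w‖ ≠ 0 := norm_ne_zero_iff.2 hw0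
  refine ⟨u', ‖w‖⁻¹ • w, ‖u‖, ⟪u', v⟫, ‖w‖, hu', hw0', ?_, ?_, hn, ?_, ?_⟩
  · rw [hu'def, smul_smul, mul_inv_cancel₀ hu', one_smul]
  · rw [smul_inv_smul₀ hw0', hw, add_sub_cancel]
  · simp [norm_smul, hw0]
  · rw [real_inner_smul_right, hw, inner_sub_right, real_inner_smul_right,
      real_inner_self_eq_norm_sq, hn]
    simp

end Ambient

/-! ### Attainment of the extreme curvatures. -/

section Compactness

variable {g : C2Metric n} {X : Sn n → EuclideanSpace ℝ (Fin (n + 1))}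

theorem continuous_fderiv_comp_radialRetraction
    (hX : ContMDiff (𝓡 n) 𝓘(ℝ, EuclideanSpace ℝ (Fin (n + 1))) 2 X) :
    Continuous fun p : Sn n =>
      fderiv ℝ (X ∘ radialRetraction) (p : EuclideanSpace ℝ (Fin (n + 1))) :=
  continuous_iff_continuousAt.2 fun p => ContinuousAt.comp
    (((contDiffAt_comp_radialRetraction hX p).fderiv_right
      (m := 1) (by norm_num)).continuousAt) continuous_subtype_val.continuousAt

theorem continuous_fderiv_fderiv_comp_radialRetraction
    (hX : ContMDiff (𝓡 n) 𝓘(ℝ, EuclideanSpace ℝ (Fin (n + 1))) 2 X) :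
    Continuous fun p : Sn n =>
      fderiv ℝ (fderiv ℝ (X ∘ radialRetraction)) (p : EuclideanSpace ℝ (Fin (n + 1))) :=
  continuous_iff_continuousAt.2 fun p => ContinuousAt.comp
    ((((contDiffAt_comp_radialRetraction hX p).fderiv_right
      (m := 1) (by norm_num)).fderiv_right (m := 0) (by norm_num)).continuousAt)
      continuous_subtype_val.continuousAt

theorem continuous_ambientMetric {α : Type*} [TopologicalSpace α]
    (hX : ContMDiff (𝓡 n) 𝓘(ℝ, EuclideanSpace ℝ (Fin (n + 1))) 2 X) {p : α → Sn n}
    {U V : α → EuclideanSpace ℝ (Fin (n + 1))} (hp : Continuous p) (hU : Continuous U)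
    (hV : Continuous V) : Continuous fun q => ambientMetric X (p q) (U q) (V q) :=
  (((continuous_fderiv_comp_radialRetraction hX).comp hp).clm_apply hU).inner
    (((continuous_fderiv_comp_radialRetraction hX).comp hp).clm_apply hV)

theorem continuous_ambientForm {α : Type*} [TopologicalSpace α]
    (hX : ContMDiff (𝓡 n) 𝓘(ℝ, EuclideanSpace ℝ (Fin (n + 1))) 2 X) {p : α → Sn n}
    {N U V : α → EuclideanSpace ℝ (Fin (n + 1))} (hp : Continuous p) (hN : Continuous N)
    (hU : Continuous U) (hV : Continuous V) :
    Continuous fun q => ambientForm X (p q) (N q) (U q) (V q) :=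
  (((((continuous_fderiv_fderiv_comp_radialRetraction hX).comp hp).clm_apply hU).clm_apply
    hV).inner hN).neg

theorem isClosed_isAmbientNormal {α : Type*} [TopologicalSpace α]
    (hX : ContMDiff (𝓡 n) 𝓘(ℝ, EuclideanSpace ℝ (Fin (n + 1))) 2 X) {p : α → Sn n}
    {N : α → EuclideanSpace ℝ (Fin (n + 1))} (hp : Continuous p) (hN : Continuous N) :
    IsClosed {q | IsAmbientNormal X (p q) (N q)} := by
  refine (isClosed_eq hN.norm continuous_const).and ?_
  simp only [Set.ofPred_forall]
  exact isClosed_iInter fun w => isClosed_eq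
    ((((continuous_fderiv_comp_radialRetraction hX).comp hp).clm_apply continuous_const).inner hN)
    continuous_const

theorem linearIndependent_fderiv_chartFrame (hX : IsC2IsometricEmbedding g X) (p : Sn n)
    {ι : Type*} {u : ι → EuclideanSpace ℝ (Fin n)} (hu : LinearIndependent ℝ u) :
    LinearIndependent ℝ fun i => fderiv ℝ (X ∘ radialRetraction) p (chartFrame p (u i)) := by
  have h := hu.map' (fderiv ℝ (X ∘ (extChartAt (𝓡 n) p).symm) 0).toLinearMap
    (LinearMap.ker_eq_bot.2 (injective_fderiv_comp_extChartAt_symm hX p 0))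
  convert! h using 1
  ext1 i
  exact (fderiv_comp_extChartAt_symm_zero hX.contMDiff p (u i)).symm

theorem ambientMetric_gram_pos (hX : IsC2IsometricEmbedding g X) (p : Sn n)
    {u v : EuclideanSpace ℝ (Fin n)} (h : LinearIndependent ℝ ![u, v]) :
    0 < ambientMetric X p (chartFrame p u) (chartFrame p u)
        * ambientMetric X p (chartFrame p v) (chartFrame p v)
        - ambientMetric X p (chartFrame p u) (chartFrame p v) ^ 2 := by
  have hdet := (Matrix.posDef_gram_of_linearIndependent (𝕜 := ℝ)
    (linearIndependent_fderiv_chartFrame hX p h)).det_pos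
  rw [Matrix.det_fin_two] at hdet
  simp only [Matrix.gram_apply, Matrix.cons_val_zero, Matrix.cons_val_one] at hdet
  rw [real_inner_comm (fderiv ℝ (X ∘ radialRetraction) p (chartFrame p u))
    (fderiv ℝ (X ∘ radialRetraction) p (chartFrame p v))] at hdet
  simpa only [ambientMetric, sq] using hdet

/-- A point, a unit normal there and an orthonormal pair of tangent vectors of the sphere. -/
def orthonormalPairs (X : Sn n → EuclideanSpace ℝ (Fin (n + 1))) :
    Set (Sn n × EuclideanSpace ℝ (Fin (n + 1)) × EuclideanSpace ℝ (Fin (n + 1)) ×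
      EuclideanSpace ℝ (Fin (n + 1))) :=
  {q | IsAmbientNormal X q.1 q.2.1 ∧ ‖q.2.2.1‖ = 1 ∧ ‖q.2.2.2‖ = 1 ∧ ⟪q.2.2.1, q.2.2.2⟫ = 0 ∧
    ⟪(q.1 : EuclideanSpace ℝ (Fin (n + 1))), q.2.2.1⟫ = 0 ∧
    ⟪(q.1 : EuclideanSpace ℝ (Fin (n + 1))), q.2.2.2⟫ = 0}

theorem isCompact_orthonormalPairs
    (hX : ContMDiff (𝓡 n) 𝓘(ℝ, EuclideanSpace ℝ (Fin (n + 1))) 2 X) :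
    IsCompact (orthonormalPairs X) := by
  have hB := isCompact_closedBall (0 : EuclideanSpace ℝ (Fin (n + 1))) 1
  refine (isCompact_univ.prod (hB.prod (hB.prod hB))).of_isClosed_subset ?_ ?_
  · refine (isClosed_isAmbientNormal hX continuous_fst (by fun_prop)).and ?_
    refine (isClosed_eq (by fun_prop) continuous_const).and ?_
    refine (isClosed_eq (by fun_prop) continuous_const).and ?_
    refine (isClosed_eq (by fun_prop) continuous_const).and ?_
    exact (isClosed_eq (by fun_prop) continuous_const).and
      (isClosed_eq (by fun_prop) continuous_const)
  · rintro q ⟨h1, h2, h3, -⟩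
    exact ⟨trivial, by simp [h1.1], by simp [h2], by simp [h3]⟩

theorem linearIndependent_of_orthonormal_pair {E : Type*} [NormedAddCommGroup E]
    [InnerProductSpace ℝ E] {u v : E} (hu : ‖u‖ = 1) (hv : ‖v‖ = 1) (h : ⟪u, v⟫ = 0) :
    LinearIndependent ℝ ![u, v] :=
  Orthonormal.linearIndependent (by
    rw [orthonormal_vecCons_iff]
    exact ⟨hu, by simpa using h, by simp [hv]⟩)

/-- Linearly independent pairs do not form a compact set, so they are normalised to pairs
orthonormal in the Euclidean metric of the ambient space, not in $g$. The normal is a variable,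
which avoids choosing it continuously. -/
theorem sectionalCurvatures_eq_image (hX : IsC2IsometricEmbedding g X) :
    sectionalCurvatures g =
      (fun q => ambientSectional X q.1 q.2.1 q.2.2.1 q.2.2.2) '' orthonormalPairs X := by
  ext k
  constructor
  · rintro ⟨p, u, v, huv, rfl⟩
    obtain ⟨N, hN⟩ := exists_isAmbientNormal hX p
    have hli : LinearIndependent ℝ ![(WithLp.toLp 2 u : EuclideanSpace ℝ (Fin n)),
        WithLp.toLp 2 v] := by
      rw [LinearIndependent.pair_iff] at huv ⊢
      intro s t hst
      refine huv s t ?_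
      simpa using congrArg WithLp.ofLp hst
    obtain ⟨u', v', a, b, c, ha, hc, hu, hv, hu', hv', huv'⟩ := exists_orthonormal_pair hli
    refine ⟨(p, N, chartFrame p u', chartFrame p v'), ⟨hN, ?_⟩, ?_⟩
    · simp [hu', hv', huv', inner_chartFrame]
    · simp only
      rw [sectional_eq_ambientSectional hX hN, hu, hv, map_add, map_smul, map_smul, map_smul,
        ambientSectional_smul_add hX.contMDiff p N _ _ b ha hc]
  · rintro ⟨⟨p, N, U, V⟩, ⟨hN, hU, hV, hUV, hpU, hpV⟩, rfl⟩
    obtain ⟨u, rfl⟩ := exists_chartFrame_eq p hpU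
    obtain ⟨v, rfl⟩ := exists_chartFrame_eq p hpV
    simp only [LinearIsometry.norm_map, LinearIsometry.inner_map_map] at hU hV hUV
    refine ⟨p, WithLp.ofLp u, WithLp.ofLp v, ?_, ?_⟩
    · have hli := linearIndependent_of_orthonormal_pair hU hV hUV
      rw [LinearIndependent.pair_iff] at hli ⊢
      intro s t hst
      exact hli s t (by simpa using congrArg (WithLp.toLp 2) hst)
    · rw [sectional_eq_ambientSectional hX hN]

theorem exists_isLeast_sectionalCurvatures (hX : IsC2IsometricEmbedding g X) (hn : 2 ≤ n) :
    ∃ κ, IsLeast (sectionalCurvatures g) κ := by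
  have hne : (sectionalCurvatures g).Nonempty := by
    refine ⟨_, ⟨EuclideanSpace.single 0 1, by simp⟩, Pi.single ⟨0, by omega⟩ 1,
      Pi.single ⟨1, by omega⟩ 1, ?_, rfl⟩
    rw [LinearIndependent.pair_iff]
    intro s t hst
    have h0 := congrFun hst ⟨0, by omega⟩
    have h1 := congrFun hst ⟨1, by omega⟩
    simp at h0 h1
    exact ⟨h0, h1⟩
  rw [sectionalCurvatures_eq_image hX] at hne ⊢
  refine ((isCompact_orthonormalPairs hX.contMDiff).image_of_continuousOn ?_).exists_isLeast hne
  have hm {U V : _ → EuclideanSpace ℝ (Fin (n + 1))} (hU : Continuous U) (hV : Continuous V) :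
      Continuous fun q : Sn n × EuclideanSpace ℝ (Fin (n + 1)) × EuclideanSpace ℝ (Fin (n + 1)) ×
        EuclideanSpace ℝ (Fin (n + 1)) => ambientMetric X q.1 (U q) (V q) :=
    continuous_ambientMetric hX.contMDiff continuous_fst hU hV
  have hf {U V : _ → EuclideanSpace ℝ (Fin (n + 1))} (hU : Continuous U) (hV : Continuous V) :
      Continuous fun q : Sn n × EuclideanSpace ℝ (Fin (n + 1)) × EuclideanSpace ℝ (Fin (n + 1)) ×
        EuclideanSpace ℝ (Fin (n + 1)) => ambientForm X q.1 q.2.1 (U q) (V q) :=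
    continuous_ambientForm hX.contMDiff continuous_fst (by fun_prop) hU hV
  have c1 : Continuous fun q : Sn n × EuclideanSpace ℝ (Fin (n + 1)) ×
      EuclideanSpace ℝ (Fin (n + 1)) × EuclideanSpace ℝ (Fin (n + 1)) => q.2.2.1 := by fun_prop
  have c2 : Continuous fun q : Sn n × EuclideanSpace ℝ (Fin (n + 1)) ×
      EuclideanSpace ℝ (Fin (n + 1)) × EuclideanSpace ℝ (Fin (n + 1)) => q.2.2.2 := by fun_prop
  refine ContinuousOn.div
    (((hf c1 c1).mul (hf c2 c2)).sub ((hf c1 c2).pow 2)).continuousOn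
    (((hm c1 c1).mul (hm c2 c2)).sub ((hm c1 c2).pow 2)).continuousOn ?_
  rintro ⟨p, N, U, V⟩ ⟨-, hU, hV, hUV, hpU, hpV⟩
  obtain ⟨u, rfl⟩ := exists_chartFrame_eq p hpU
  obtain ⟨v, rfl⟩ := exists_chartFrame_eq p hpV
  simp only [LinearIsometry.norm_map, LinearIsometry.inner_map_map] at hU hV hUV
  exact (ambientMetric_gram_pos hX p (linearIndependent_of_orthonormal_pair hU hV hUV)).ne'

/-- A point, a unit normal there and an orthonormal frame of the tangent space of the sphere. -/
def orthonormalFrames (X : Sn n → EuclideanSpace ℝ (Fin (n + 1))) :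
    Set (Sn n × EuclideanSpace ℝ (Fin (n + 1)) × (Fin n → EuclideanSpace ℝ (Fin (n + 1)))) :=
  {q | IsAmbientNormal X q.1 q.2.1 ∧
    (∀ i j, ⟪q.2.2 i, q.2.2 j⟫ = (1 : Matrix (Fin n) (Fin n) ℝ) i j) ∧
    ∀ i, ⟪(q.1 : EuclideanSpace ℝ (Fin (n + 1))), q.2.2 i⟫ = 0}

theorem isCompact_orthonormalFrames
    (hX : ContMDiff (𝓡 n) 𝓘(ℝ, EuclideanSpace ℝ (Fin (n + 1))) 2 X) :
    IsCompact (orthonormalFrames X) := by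
  have hB := isCompact_closedBall (0 : EuclideanSpace ℝ (Fin (n + 1))) 1
  refine (isCompact_univ.prod (hB.prod
    (isCompact_univ_pi fun _ : Fin n => hB))).of_isClosed_subset ?_ ?_
  · refine (isClosed_isAmbientNormal hX continuous_fst (by fun_prop)).and (IsClosed.and ?_ ?_)
    · simp only [Set.ofPred_forall]
      exact isClosed_iInter fun i => isClosed_iInter fun j =>
        isClosed_eq (by fun_prop) continuous_const
    · simp only [Set.ofPred_forall]
      exact isClosed_iInter fun i => isClosed_eq (by fun_prop) continuous_const
  · rintro q ⟨h1, h2, -⟩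
    refine ⟨trivial, by simp [h1.1], fun i _ => ?_⟩
    have h := h2 i i
    rw [real_inner_self_eq_norm_sq, Matrix.one_apply_eq] at h
    rw [mem_closedBall_zero_iff]
    exact (pow_le_one_iff_of_nonneg (norm_nonneg _) two_ne_zero).1 h.le

/-- The first fundamental form in a frame. -/
noncomputable def frameMetric (X : Sn n → EuclideanSpace ℝ (Fin (n + 1))) (p : Sn n)
    (e : Fin n → EuclideanSpace ℝ (Fin (n + 1))) : Matrix (Fin n) (Fin n) ℝ :=
  fun i j => ambientMetric X p (e i) (e j)

/-- The second fundamental form in a frame. -/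
noncomputable def frameForm (X : Sn n → EuclideanSpace ℝ (Fin (n + 1))) (p : Sn n)
    (N : EuclideanSpace ℝ (Fin (n + 1))) (e : Fin n → EuclideanSpace ℝ (Fin (n + 1))) :
    Matrix (Fin n) (Fin n) ℝ :=
  fun i j => ambientForm X p N (e i) (e j)

theorem frameMetric_chartFrame (hX : IsC2IsometricEmbedding g X) (p : Sn n)
    (P : Matrix (Fin n) (Fin n) ℝ) :
    frameMetric X p (fun i => chartFrame p (WithLp.toLp 2 (P.col i))) =
      Pᵀ * chartMetric g p (extChartAt (𝓡 n) p p) * P := by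
  ext i j
  rw [congruence_apply, dotProduct_chartMetric_mulVec hX, frameMetric]

theorem frameForm_chartFrame (hX : IsC2IsometricEmbedding g X) {p : Sn n}
    {N : EuclideanSpace ℝ (Fin (n + 1))} (hN : IsAmbientNormal X p N)
    (P : Matrix (Fin n) (Fin n) ℝ) :
    frameForm X p N (fun i => chartFrame p (WithLp.toLp 2 (P.col i))) =
      Pᵀ * secondFundamentalForm X p N * P := by
  ext i j
  rw [congruence_apply, dotProduct_secondFundamentalForm_mulVec hX hN, frameForm]

/-- The norm of the Ricci tensor in terms of the fundamental forms in a frame. -/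
noncomputable def frameRicciNorm (X : Sn n → EuclideanSpace ℝ (Fin (n + 1))) (p : Sn n)
    (N : EuclideanSpace ℝ (Fin (n + 1))) (e : Fin n → EuclideanSpace ℝ (Fin (n + 1))) : ℝ :=
  tensorNorm (frameMetric X p e) (gaussRicci (frameMetric X p e) (frameForm X p N e))

theorem frameRicciNorm_chartFrame (hX : IsC2IsometricEmbedding g X) {p : Sn n}
    {N : EuclideanSpace ℝ (Fin (n + 1))} (hN : IsAmbientNormal X p N)
    {P : Matrix (Fin n) (Fin n) ℝ} (hP : IsUnit P.det) :
    frameRicciNorm X p N (fun i => chartFrame p (WithLp.toLp 2 (P.col i))) = ricciNorm g p := by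
  rw [frameRicciNorm, frameMetric_chartFrame hX, frameForm_chartFrame hX hN,
    gaussRicci_congruence hP, tensorNorm_congruence hP, ricciNorm, ricci_chartMetric hX hN]

theorem exists_eq_chartFrame_col {p : Sn n} {e : Fin n → EuclideanSpace ℝ (Fin (n + 1))}
    (he : ∀ i j, ⟪e i, e j⟫ = (1 : Matrix (Fin n) (Fin n) ℝ) i j)
    (hp : ∀ i, ⟪(p : EuclideanSpace ℝ (Fin (n + 1))), e i⟫ = 0) :
    ∃ P : Matrix (Fin n) (Fin n) ℝ, IsUnit P.det ∧
      e = fun i => chartFrame p (WithLp.toLp 2 (P.col i)) := by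
  choose f hf using fun i => exists_chartFrame_eq p (hp i)
  refine ⟨Matrix.of fun j i => f i j, ?_, funext fun i => (hf i).symm⟩
  refine Matrix.isUnit_det_of_left_inverse (B := (Matrix.of fun j i => f i j)ᵀ) ?_
  ext i j
  rw [← he, ← hf, ← hf, LinearIsometry.inner_map_map, PiLp.inner_apply, Matrix.mul_apply]
  refine Finset.sum_congr rfl fun k _ => ?_
  exact mul_comm _ _

/-- A whole frame is carried because the Ricci norm contracts over all directions. By congruence
invariance every frame at $p$ gives the same value, and the chart frame is one of them. -/
theorem range_ricciNorm_eq_image (hX : IsC2IsometricEmbedding g X) :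
    Set.range (ricciNorm g) =
      (fun q => frameRicciNorm X q.1 q.2.1 q.2.2) '' orthonormalFrames X := by
  ext r
  constructor
  · rintro ⟨p, rfl⟩
    obtain ⟨N, hN⟩ := exists_isAmbientNormal hX p
    have h1 : IsUnit (1 : Matrix (Fin n) (Fin n) ℝ).det := by simp
    refine ⟨(p, N, fun i => chartFrame p (WithLp.toLp 2 ((1 : Matrix (Fin n) (Fin n) ℝ).col i))),
      ⟨hN, fun i j => ?_, fun i => inner_chartFrame p _⟩, frameRicciNorm_chartFrame hX hN h1⟩
    rw [LinearIsometry.inner_map_map, PiLp.inner_apply]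
    simp [Matrix.one_apply, eq_comm]
  · rintro ⟨⟨p, N, e⟩, ⟨hN, he, hp⟩, rfl⟩
    obtain ⟨P, hP, rfl⟩ := exists_eq_chartFrame_col (p := p) (e := e) he hp
    exact ⟨p, (frameRicciNorm_chartFrame hX hN hP).symm⟩

theorem exists_isGreatest_ricciNorm (hX : IsC2IsometricEmbedding g X) :
    ∃ Λ, IsGreatest (Set.range (ricciNorm g)) Λ := by
  have hne : (Set.range (ricciNorm g)).Nonempty :=
    ⟨_, ⟨EuclideanSpace.single 0 1, by simp⟩, rfl⟩
  rw [range_ricciNorm_eq_image hX] at hne ⊢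
  refine ((isCompact_orthonormalFrames hX.contMDiff).image_of_continuousOn ?_).exists_isGreatest hne
  rintro ⟨p, N, e⟩ ⟨hN, he, hp⟩
  have hm (i j : Fin n) : Continuous fun q : Sn n × EuclideanSpace ℝ (Fin (n + 1)) ×
      (Fin n → EuclideanSpace ℝ (Fin (n + 1))) => frameMetric X q.1 q.2.2 i j :=
    continuous_ambientMetric hX.contMDiff continuous_fst (by fun_prop) (by fun_prop)
  have hf (i j : Fin n) : ContinuousAt (fun q : Sn n × EuclideanSpace ℝ (Fin (n + 1)) ×
      (Fin n → EuclideanSpace ℝ (Fin (n + 1))) => frameForm X q.1 q.2.1 q.2.2 i j) (p, N, e) :=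
    (continuous_ambientForm hX.contMDiff continuous_fst (by fun_prop) (by fun_prop)
      (by fun_prop)).continuousAt
  -- The inverse metric is continuous only where the frame is nondegenerate, hence continuity is
  -- checked at points of `orthonormalFrames X` only.
  have hdet : IsUnit (frameMetric X p e).det := by
    obtain ⟨P, hP, rfl⟩ := exists_eq_chartFrame_col (p := p) (e := e) he hp
    rw [frameMetric_chartFrame hX, Matrix.det_mul, Matrix.det_mul, Matrix.det_transpose]
    exact (hP.mul (isUnit_iff_ne_zero.2 (posDef_chartMetric hX p _).det_pos.ne')).mul hP
  have hinv (i j : Fin n) := Matrix.continuousAt_inv_apply (x := (p, N, e))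
    (fun i j => (hm i j).continuousAt) hdet i j
  refine ContinuousAt.continuousWithinAt ?_
  simp only [frameRicciNorm, tensorNorm, gaussRicci_apply]
  refine ContinuousAt.sqrt ?_
  fun_prop

end Compactness

theorem theorem5p5 (n : ℕ) (hn : 3 ≤ n) (g : C2Metric n)
    (hg : ∀ k ∈ sectionalCurvatures g, 0 < k)
    (X : Sn n → EuclideanSpace ℝ (Fin (n + 1))) (hX : IsC2IsometricEmbedding g X) :
    ∃ κ Λ : ℝ, IsLeast (sectionalCurvatures g) κ ∧ IsGreatest (Set.range (ricciNorm g)) Λ ∧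
      ∀ (p : Sn n) (N : EuclideanSpace ℝ (Fin (n + 1))), IsUnitNormal X p N →
        secondFundamentalFormNorm g X p N ≤
          (n : ℝ) / (2 * Real.sqrt (((n : ℝ) - 1) * ((n : ℝ) - 2))) * Λ * κ ^ (-(1 / 2) : ℝ) := by
  obtain ⟨κ, hκ⟩ := exists_isLeast_sectionalCurvatures hX (by omega)
  obtain ⟨Λ, hΛ⟩ := exists_isGreatest_ricciNorm hX
  refine ⟨κ, Λ, hκ, hΛ, fun p N hN => ?_⟩
  have hκ0 : 0 < κ := hg κ hκ.1
  have hN' := hN.isAmbientNormal hX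
  have hmain := tensorNorm_le_gaussRicci (by omega)
    (posDef_chartMetric hX p (extChartAt (𝓡 n) p p))
    (isSymm_secondFundamentalForm hX.contMDiff p N) hκ0.le (fun u v huv => by
      have hle := hκ.2 ⟨p, u, v, huv, rfl⟩
      rw [sectional_chartMetric hX hN', le_div_iff₀] at hle
      · exact hle
      · simp only [dotProduct_chartMetric_mulVec hX]
        refine ambientMetric_gram_pos hX p ?_
        rw [LinearIndependent.pair_iff] at huv ⊢
        exact fun s t hst => huv s t (by simpa using congrArg WithLp.ofLp hst))
  rw [← ricci_chartMetric hX hN'] at hmain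
  have hΛp : ricciNorm g p ≤ Λ := hΛ.2 ⟨p, rfl⟩
  have hn' : (3 : ℝ) ≤ n := by exact_mod_cast hn
  have hc : 0 < ((n : ℝ) - 1) * ((n : ℝ) - 2) := mul_pos (by linarith) (by linarith)
  have hsc := Real.sqrt_pos.2 hc
  have hsκ := Real.sqrt_pos.2 hκ0
  have hΛ0 : 0 ≤ Λ := (Real.sqrt_nonneg _).trans hΛp
  rw [Real.sqrt_mul hc.le] at hmain
  have h1 : secondFundamentalFormNorm g X p N ≤
      Λ / (Real.sqrt (((n : ℝ) - 1) * ((n : ℝ) - 2)) * Real.sqrt κ) := by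
    rw [le_div_iff₀ (mul_pos hsc hsκ), mul_comm]
    exact hmain.trans hΛp
  -- `h1` already holds with the constant $1/\sqrt{(n-1)(n-2)}$; the stated one is larger by the
  -- factor $n/2\ge1$.
  refine h1.trans ?_
  rw [Real.rpow_neg hκ0.le, ← Real.sqrt_eq_rpow]
  have h2 : (n : ℝ) / (2 * Real.sqrt (((n : ℝ) - 1) * ((n : ℝ) - 2))) * Λ * (Real.sqrt κ)⁻¹ =
      (n / 2) * (Λ / (Real.sqrt (((n : ℝ) - 1) * ((n : ℝ) - 2)) * Real.sqrt κ)) := by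
    field_simp
  rw [h2]
  exact le_mul_of_one_le_left (by positivity) (by linarith)
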